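/- **Theorem (GMM optimality).** Let $\mathcal X$ be a finite set, let $Q$ be a probability distribution on $\mathcal X$ with $Q(x)>0$ for all $x$, and let $X_1,X_2,\dots$ be i.i.d. from $Q$, with empirical type $P_n=n^{-1}\sum_{i\le n}\delta_{X_i}\in\mathbb R^{\mathcal X}$. Let $h:\mathcal X\to\mathbb R^d$, let $\Theta$ be a parameter set, and for $\theta\in\Theta$ let $\alpha(\theta)\in\mathbb R^d$ and $$E_\theta=\Big\{P\in\mathbb R^{\mathcal X}:\ P(x)>0\ \text{for all } x,\ \sum_xP(x)=1,\ \sum_xP(x)h(x)=\alpha(\theta)\Big\},$$ $$\mathsf T^*_\theta=\Big\{v\in\mathbb R^{\mathcal X}:\ \sum_xv(x)=0,\ \sum_xv(x)h(x)=0\Big\}.$$ Let $P^*_\theta$ be the information projection of $Q$ onto $E_\theta$, i.e. a minimizer of $\sum_xP(x)\log\frac{P(x)}{Q(x)}$ over $P\in E_\theta$ (assumed to exist). Let $V$ be a matrix whose columns form an orthonormal basis of $\mathsf T^*_\theta$ (this space does not depend on $\theta$), and let $$H^*_\theta=V^\top\mathrm{diag}(1/P^*_\theta)\,V$$ be the information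 metric on $\mathsf T^*_\theta$ in the coordinates $V$. Let $g:\mathcal X\times\Theta\to\mathbb R^q$ be a moment function, with sample moments $\bar g_n(\theta)=n^{-1}\sum_{i\le n}g(X_i,\theta)$ and moment map $A_\theta:\mathbb R^{\mathcal X}\to\mathbb R^q$, $A_\theta v=\sum_xv(x)g(x,\theta)$ (the derivative of $P\mapsto\mathbb E_P[g(X,\theta)]$); in the coordinates $V$ the restriction $A_\theta|_{\mathsf T^*_\theta}$ is the $q\times r$ matrix $A_\theta V$, where $r=\dim\mathsf T^*_\theta$. Assume that for every $\theta\in\Theta$: * $\mathbb E_{P^*_\theta}[g(X,\theta)]=0$; * $A_\theta$ maps $\mathsf T^*_\theta$ onto $\mathbb R^q$; * each of the subspaces $\mathsf T^*_\theta$ and $\mathsf T^*_\theta\cap\ker A_\theta$ is spanned by vectors with integer coordinates (as is the case when $h$ and $g(\cdot,\theta)-g(x_0,\theta)$, for a fixed $x_0\in\mathcal X$, take rational values). Define the conditional likelihood $\mathcal L_{\mathrm{cond}}(\theta)$ as the conditional probability, given $P_n\in E_\theta$, of the observed value of the sample moment, normalized to have maximal value one: $$\mathcal L_{\mathrm{cond}}(\theta)=\frac{L_n(\bar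 g_n(\theta))}{\sup_{\gamma\in\mathbb R^q}L_n(\gamma)},\qquad L_n(\gamma)=\Pr\big(\bar g_n(\theta)=\gamma\ \big|\ P_n\in E_\theta\big).$$ Then for every $\theta\in\Theta$ the matrices $H^*_\theta$ and $(A_\theta|_{\mathsf T^*_\theta})H_\theta^{*-1}(A_\theta|_{\mathsf T^*_\theta})^\top$ are positive definite; the matrix $$W^{\mathrm{opt}}_\theta=\Big[(A_\theta|_{\mathsf T^*_\theta})\,H_\theta^{*-1}\,(A_\theta|_{\mathsf T^*_\theta})^\top\Big]^{-1}$$ is the metric induced on moment space by the information metric through the moment map, i.e. for all $u\in\mathbb R^q$ $$u^\top W^{\mathrm{opt}}_\theta u=\min\Big\{\sum_x\frac{v(x)^2}{P^*_\theta(x)}:\ v\in\mathsf T^*_\theta,\ A_\theta v=u\Big\};$$ and $$-\log\mathcal L_{\mathrm{cond}}(\theta)=\frac n2\,\bar g_n(\theta)^\top W^{\mathrm{opt}}_\theta\,\bar g_n(\theta)+O_p(n^{-1/2}),$$ where $O_p$ refers to the conditional laws $\Pr(\,\cdot\mid P_n\in E_\theta)$, as $n\to\infty$ through those $n$ for which $\Pr(P_n\in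 E_\theta)>0$. -/

import Mathlib

open MeasureTheory ProbabilityTheory Matrix

noncomputable section

namespace ConstrainedGMM

variable {𝒳 : Type*} [Fintype 𝒳] [DecidableEq 𝒳] {Ω : Type*} {d q r : ℕ}

/-- The open probability simplex on the finite sample space `𝒳`, as a set of vectors. -/
def openSimplex (𝒳 : Type*) [Fintype 𝒳] : Set (𝒳 → ℝ) :=
  {P | (∀ x, 0 < P x) ∧ ∑ x, P x = 1}

/-- The moment map `P ↦ E_P[f(X)] = ∑ x, P(x) f(x)` of a vector-valued function `f`, as a linear
map on all of `ℝ^𝒳`.  Being linear, it is its own derivative at every `P`. -/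
def momentMap (f : 𝒳 → Fin q → ℝ) : (𝒳 → ℝ) →ₗ[ℝ] (Fin q → ℝ) :=
  (Matrix.of fun (j : Fin q) (x : 𝒳) => f x j).mulVecLin

/-- The constraint set `E = {P in the open simplex : E_P[h(X)] = α}`. -/
def constraintSet (h : 𝒳 → Fin d → ℝ) (α : Fin d → ℝ) : Set (𝒳 → ℝ) :=
  {P | P ∈ openSimplex 𝒳 ∧ momentMap h P = α}

/-- The Kullback–Leibler divergence on a finite space. -/
def klDivergence (P Q : 𝒳 → ℝ) : ℝ := ∑ x, P x * Real.log (P x / Q x)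

/-- `Pstar` is the information projection of `Q` onto `E`. -/
def IsInformationProjection (Q : 𝒳 → ℝ) (E : Set (𝒳 → ℝ)) (Pstar : 𝒳 → ℝ) : Prop :=
  Pstar ∈ E ∧ ∀ P ∈ E, klDivergence Pstar Q ≤ klDivergence P Q

/-- The tangent space `{v : ∑ x, v x = 0, A v = 0}` of the constraint set, where `A` is the matrix
with columns `h(x)`. -/
def tangentSpace (h : 𝒳 → Fin d → ℝ) : Submodule ℝ (𝒳 → ℝ) where
  carrier := {v | ∑ x, v x = 0 ∧ momentMap h v = 0}
  zero_mem' := by simp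
  add_mem' := by
    rintro v w ⟨hv, hv'⟩ ⟨hw, hw'⟩
    refine ⟨?_, ?_⟩
    · simp [Finset.sum_add_distrib, hv, hw]
    · rw [map_add, hv', hw', add_zero]
  smul_mem' := by
    rintro c v ⟨hv, hv'⟩
    refine ⟨?_, ?_⟩
    · simp [← Finset.mul_sum, hv]
    · rw [map_smul, hv', smul_zero]

/-- The columns of `V` form an orthonormal basis of `T` (Euclidean inner product). -/
def IsOrthonormalBasisOf (V : Matrix 𝒳 (Fin r) ℝ) (T : Submodule ℝ (𝒳 → ℝ)) : Prop :=
  Vᵀ * V = 1 ∧ LinearMap.range V.mulVecLin = T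

/-- The projected Hessian `H* = Vᵀ diag(1/P*) V`: the information metric at `P*` in the
orthonormal tangent coordinates `V`. -/
def projectedHessian (V : Matrix 𝒳 (Fin r) ℝ) (Pstar : 𝒳 → ℝ) : Matrix (Fin r) (Fin r) ℝ :=
  Vᵀ * Matrix.diagonal (fun x => 1 / Pstar x) * V

/-- The matrix of the moment map of `f` restricted to the tangent space, in the coordinates `V`. -/
def restrictedMoment (f : 𝒳 → Fin q → ℝ) (V : Matrix 𝒳 (Fin r) ℝ) : Matrix (Fin q) (Fin r) ℝ :=
  (Matrix.of fun (j : Fin q) (x : 𝒳) => f x j) * V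

/-- The pushforward `(A|_T) H*⁻¹ (A|_T)ᵀ` of the inverse metric tensor through the moment map. -/
def pushforwardMetric (f : 𝒳 → Fin q → ℝ) (V : Matrix 𝒳 (Fin r) ℝ) (Pstar : 𝒳 → ℝ) :
    Matrix (Fin q) (Fin q) ℝ :=
  restrictedMoment f V * (projectedHessian V Pstar)⁻¹ * (restrictedMoment f V)ᵀ

/-- The weight `W = [(A|_T) H*⁻¹ (A|_T)ᵀ]⁻¹`. -/
def optimalWeight (f : 𝒳 → Fin q → ℝ) (V : Matrix 𝒳 (Fin r) ℝ) (Pstar : 𝒳 → ℝ) :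
    Matrix (Fin q) (Fin q) ℝ :=
  (pushforwardMetric f V Pstar)⁻¹

/-- A linear subspace of `ℝ^𝒳` that is spanned by its vectors with integer coordinates. -/
def SpannedByIntegerVectors (S : Submodule ℝ (𝒳 → ℝ)) : Prop :=
  Submodule.span ℝ {v : 𝒳 → ℝ | v ∈ S ∧ ∀ x, ∃ z : ℤ, v x = z} = S

/-- The empirical type `P_n = n⁻¹ ∑_{i < n} δ_{X_i}`, as a vector of frequencies. -/
def empiricalType (X : ℕ → Ω → 𝒳) (n : ℕ) (ω : Ω) : 𝒳 → ℝ :=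
  fun x => (n : ℝ)⁻¹ * ∑ i ∈ Finset.range n, if X i ω = x then 1 else 0

/-- The sample moment `n⁻¹ ∑_{i < n} f(X_i)`. -/
def sampleMoment (X : ℕ → Ω → 𝒳) (f : 𝒳 → Fin q → ℝ) (n : ℕ) (ω : Ω) : Fin q → ℝ :=
  (n : ℝ)⁻¹ • ∑ i ∈ Finset.range n, f (X i ω)

variable [MeasurableSpace Ω]

/-- The conditional law `Pr(· | P_n ∈ E)` of the experiment given that the empirical type of the
first `n` observations satisfies the constraint (the zero measure if this has probability zero). -/
def condLaw (μ : Measure Ω) (X : ℕ → Ω → 𝒳) (E : Set (𝒳 → ℝ)) (n : ℕ) : Measure Ω :=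
  ProbabilityTheory.cond μ {ω | empiricalType X n ω ∈ E}

/-- The conditional probability mass function `γ ↦ Pr(n⁻¹ ∑_{i < n} f(X_i) = γ | P_n ∈ E)` of the
sample moment. -/
def condMomentPMF (μ : Measure Ω) (X : ℕ → Ω → 𝒳) (E : Set (𝒳 → ℝ)) (f : 𝒳 → Fin q → ℝ)
    (n : ℕ) (γ : Fin q → ℝ) : ℝ :=
  (condLaw μ X E n).real {ω | sampleMoment X f n ω = γ}

/-- The conditional likelihood: the conditional probability, given `P_n ∈ E`, of the sample moment
that was observed, normalized (as a likelihood is only defined up to a factor that does not depend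
on the data) so that its largest possible value is one. -/
def condLikelihood (μ : Measure Ω) (X : ℕ → Ω → 𝒳) (E : Set (𝒳 → ℝ)) (f : 𝒳 → Fin q → ℝ)
    (n : ℕ) (ω : Ω) : ℝ :=
  condMomentPMF μ X E f n (sampleMoment X f n ω) / ⨆ γ : Fin q → ℝ, condMomentPMF μ X E f n γ

/-- `R_n = O_p(a_n)` under the sequence of laws `ν_n`. -/
def IsBigOInProbability (ν : ℕ → Measure Ω) (R : ℕ → Ω → ℝ) (a : ℕ → ℝ) : Prop :=
  ∀ ε : ℝ, 0 < ε → ∃ C : ℝ, ∃ N : ℕ, ∀ n : ℕ, N ≤ n →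
    (ν n) {ω | C * a n < |R n ω|} ≤ ENNReal.ofReal ε

end ConstrainedGMM

end

/-!
The vector of counts of `n` independent draws is multinomial, that is, a product of Poisson weights
conditioned on its sum. Stirling's formula gives a local limit theorem with error `O(n^{-1/2})` for
these weights: relative to the scale on which they are measured, the weight at counts `N` is
`exp (-‖s‖² / 2)`, where `s` is the deviation of `N` from its mean in units of the Poisson standard
deviations. In these units the Euclidean metric is the information metric.

The gradient of the divergence at the information projection `P` is orthogonal to the tangent
space `T`, so the likelihood ratio of `P` to `Q` takes the same value at all samples whose type
lies in the constraint set. Conditionally on the constraint the draws may therefore be taken from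
`P`. The counts with a given sample moment form a coset of the integer points of `T ∩ ker A`, and
the sum of `exp (-‖s‖² / 2)` over such a coset is a Riemann sum of a Gaussian integral: up to a
common factor it is `exp (-ρ² / 2)`, where `ρ` is the distance of the coset from the mean. By
duality of quadratic forms `ρ²` is the quadratic form of the induced metric on moment space,
evaluated at `√n` times the sample moment. The likelihood is maximal up to `O(n^{-1/2})` on the
coset nearest to the mean, where `ρ = O(n^{-1/2})`. Taking logarithms is harmless as long as `ρ`
stays bounded, which the Gaussian tail of the weights ensures up to small conditional probability.
-/

noncomputable section

namespace ConstrainedGMM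

section Poisson

open Filter InformationTheory Real Topology

/-! ### The local limit theorem for Poisson weights -/

theorem log_stirlingSeq_le {k : ℕ} (hk : k ≠ 0) :
    log (Stirling.stirlingSeq k) ≤ log √π + 1 / (12 * k) := by
  obtain ⟨j, rfl⟩ := Nat.exists_eq_succ_of_ne_zero hk
  let u : ℕ → ℝ := fun m => log (Stirling.stirlingSeq (m + 1)) - 1 / (12 * ((m : ℝ) + 1))
  have hmono : Monotone u := by
    refine monotone_nat_of_le_succ fun m => ?_
    have hstep := Stirling.log_stirlingSeq_sdiff_le (m + 1)
    have htelescope : (1 : ℝ) / (12 * ((m + 1 : ℕ) : ℝ) * (((m + 1 : ℕ) : ℝ) + 1)) =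
        1 / (12 * ((m : ℝ) + 1)) - 1 / (12 * (((m + 1 : ℕ) : ℝ) + 1)) := by
      push_cast
      field_simp
      ring
    simp only [u]
    linarith
  have hlim : Tendsto u atTop (𝓝 (log √π - 1 / 12 * 0)) := by
    refine Tendsto.sub ?_ ?_
    · exact ((continuousAt_log (by positivity)).tendsto.comp
        Stirling.tendsto_stirlingSeq_sqrt_pi).comp (tendsto_add_atTop_nat 1)
    · refine (tendsto_one_div_add_atTop_nhds_zero_nat.const_mul (1 / 12)).congr fun m => ?_
      field_simp
  have := hmono.ge_of_tendsto hlim j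
  simp only [u, Nat.succ_eq_add_one, Nat.cast_add, Nat.cast_one] at this ⊢
  linarith

theorem sq_sub_one_le_mul_klFun {y M : ℝ} (hy : 0 < y) (hM : y ≤ M) :
    (y - 1) ^ 2 ≤ (√M + 1) ^ 2 * klFun y := by
  have hsqrt : 0 < √y := sqrt_pos.2 hy
  have hsq : √y ^ 2 = y := sq_sqrt hy.le
  have hlog : -log √y ≤ 1 / √y - 1 := by
    simpa only [one_div, log_inv] using log_le_sub_one_of_pos (one_div_pos.2 hsqrt)
  have hhellinger : (√y - 1) ^ 2 ≤ klFun y := by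
    have := mul_le_mul_of_nonneg_left hlog hy.le
    have hdiv : y * (1 / √y) = √y := by rw [mul_one_div, div_sqrt]
    rw [log_sqrt hy.le] at this
    rw [klFun_apply]
    nlinarith
  calc (y - 1) ^ 2 = (√y + 1) ^ 2 * (√y - 1) ^ 2 := by
        rw [← mul_pow]
        congr 1
        linear_combination -hsq
    _ ≤ (√M + 1) ^ 2 * klFun y := by gcongr

theorem abs_log_one_add_le {d : ℝ} (hd : |d| ≤ 1 / 2) : |log (1 + d)| ≤ 2 * |d| := by
  have := abs_log_sub_add_sum_range_le (x := -d) (by rw [abs_neg]; linarith) 0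
  simp only [Finset.range_zero, Finset.sum_empty, zero_add, sub_neg_eq_add, abs_neg,
    pow_one] at this
  refine this.trans ?_
  rw [div_le_iff₀ (by linarith)]
  nlinarith [abs_nonneg d]

theorem abs_log_one_add_sub_le {d : ℝ} (hd : |d| ≤ 1 / 2) :
    |log (1 + d) - (d - d ^ 2 / 2)| ≤ 2 * |d| ^ 3 := by
  have := abs_log_sub_add_sum_range_le (x := -d) (by rw [abs_neg]; linarith) 2
  simp only [Finset.sum_range_succ, Finset.range_zero, Finset.sum_empty, zero_add,
    sub_neg_eq_add, abs_neg, pow_one, Nat.cast_zero, Nat.cast_one, div_one] at this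
  calc |log (1 + d) - (d - d ^ 2 / 2)|
      = |-d + (-d) ^ (1 + 1) / (1 + 1) + log (1 + d)| := by congr 1; ring
    _ ≤ |d| ^ 3 / (1 - |d|) := this
    _ ≤ 2 * |d| ^ 3 := by
        rw [div_le_iff₀ (by linarith)]
        nlinarith [pow_nonneg (abs_nonneg d) 3]

theorem abs_klFun_one_add_sub_le {d : ℝ} (hd : |d| ≤ 1 / 2) :
    |klFun (1 + d) - d ^ 2 / 2| ≤ 4 * |d| ^ 3 := by
  have hfactor : |1 + d| ≤ 3 / 2 := (abs_add_le _ _).trans (by rw [abs_one]; linarith)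
  calc |klFun (1 + d) - d ^ 2 / 2|
      = |-(d ^ 3 / 2) + (1 + d) * (log (1 + d) - (d - d ^ 2 / 2))| := by
        rw [klFun_apply]; congr 1; ring
    _ ≤ |d| ^ 3 / 2 + |1 + d| * |log (1 + d) - (d - d ^ 2 / 2)| := by
        refine (abs_add_le _ _).trans_eq ?_
        rw [abs_neg, abs_div, abs_pow, abs_mul, abs_two]
    _ ≤ |d| ^ 3 / 2 + 3 / 2 * (2 * |d| ^ 3) := by
        gcongr
        exact abs_log_one_add_sub_le hd
    _ ≤ 4 * |d| ^ 3 := by linarith [pow_nonneg (abs_nonneg d) 3]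

theorem abs_exp_sub_exp_le (s t : ℝ) : |exp s - exp t| ≤ |s - t| * (exp s + exp t) := by
  wlog h : t ≤ s generalizing s t
  · rw [abs_sub_comm, abs_sub_comm s, add_comm]
    exact this t s (le_of_not_ge h)
  rw [abs_of_nonneg (sub_nonneg.2 (exp_le_exp.2 h)), abs_of_nonneg (sub_nonneg.2 h)]
  have htangent : exp s * (t - s + 1) ≤ exp t := by
    calc exp s * (t - s + 1) ≤ exp s * exp (t - s) := by gcongr; exact add_one_le_exp _
      _ = exp t := by rw [← exp_add, add_sub_cancel]
  nlinarith [mul_nonneg (sub_nonneg.2 h) (exp_pos t).le]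

theorem pow_mul_exp_neg_mul_le (m : ℕ) {c t : ℝ} (hc : 0 < c) (ht : 0 ≤ t) :
    t ^ m * exp (-(c * t)) ≤ m.factorial / c ^ m := by
  have := pow_div_factorial_le_exp (c * t) (by positivity) m
  rw [exp_neg, ← div_eq_mul_inv, div_le_div_iff₀ (exp_pos _) (by positivity)]
  rw [div_le_iff₀ (by positivity)] at this
  linarith [mul_pow c t m]

theorem abs_pow_mul_exp_neg_mul_sq_le (m : ℕ) {c : ℝ} (hc : 0 < c) (z : ℝ) :
    |z| ^ m * exp (-(c * z ^ 2)) ≤ 1 + m.factorial / c ^ m := by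
  have hpow : |z| ^ m ≤ 1 + (z ^ 2) ^ m := by
    have : (z ^ 2) ^ m = (|z| ^ m) ^ 2 := by rw [← sq_abs]; ring
    rw [this]
    nlinarith [sq_nonneg (|z| ^ m - 1)]
  calc |z| ^ m * exp (-(c * z ^ 2))
      ≤ (1 + (z ^ 2) ^ m) * exp (-(c * z ^ 2)) := by gcongr
    _ = exp (-(c * z ^ 2)) + (z ^ 2) ^ m * exp (-(c * z ^ 2)) := by ring
    _ ≤ 1 + m.factorial / c ^ m :=
        add_le_add (exp_le_one_iff.2 (by simp only [neg_nonpos]; positivity))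
          (pow_mul_exp_neg_mul_le m hc (sq_nonneg z))

/-- The deviation of a count `t` from its mean `l`, in units of the Poisson standard deviation. -/
def poissonScore (l t : ℝ) : ℝ := (t - l) / √l

/-- The Poisson probability of the count `k` at mean `l`, multiplied by `√(2πl)` so that it is
comparable to `exp (-z² / 2)` at the score `z = (k - l) / √l`. -/
def poissonTerm (l : ℝ) (k : ℕ) : ℝ :=
  √(2 * π * l) * exp (-l) * l ^ k / k.factorial

theorem poissonScore_sq {l : ℝ} (hl : 0 < l) (t : ℝ) :
    poissonScore l t ^ 2 = l * (t / l - 1) ^ 2 := by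
  rw [poissonScore, div_pow, sq_sqrt hl.le]
  field_simp

theorem abs_div_sub_one_eq {l : ℝ} (hl : 0 < l) (t : ℝ) :
    |t / l - 1| = |poissonScore l t| / √l := by
  rw [poissonScore, abs_div, abs_of_pos (sqrt_pos.2 hl), div_div, mul_self_sqrt hl.le,
    div_sub_one hl.ne', abs_div, abs_of_pos hl]

theorem poissonTerm_pos {l : ℝ} (hl : 0 < l) (k : ℕ) : 0 < poissonTerm l k := by
  unfold poissonTerm
  positivity

theorem log_poissonTerm {l : ℝ} (hl : 0 < l) {k : ℕ} (hk : k ≠ 0) :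
    log (poissonTerm l k) = -(1 / 2) * log (k / l) - l * klFun (k / l)
      - (log (Stirling.stirlingSeq k) - log √π) := by
  have hk' : (0 : ℝ) < k := by positivity
  have hstirling := Stirling.log_stirlingSeq_formula k
  have hkl : l * klFun (k / l) = k * log (k / l) - k + l := by
    rw [klFun_apply]
    field_simp
    ring
  rw [log_div hk'.ne' (exp_pos 1).ne', log_exp, log_mul two_ne_zero hk'.ne'] at hstirling
  rw [hkl, poissonTerm, log_div (by positivity) (by positivity),
    log_mul (by positivity) (by positivity), log_mul (by positivity) (by positivity), log_exp,
    log_pow, log_sqrt (by positivity), log_mul (by positivity) hl.ne',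
    log_mul two_ne_zero pi_pos.ne', log_sqrt pi_pos.le, log_div hk'.ne' hl.ne']
  linarith

theorem poissonTerm_le {l M c : ℝ} {k : ℕ} (hl : 0 < l) (hk : k ≠ 0) (hkM : k ≤ M * l)
    (hc : 0 ≤ c) (hcM : c * (√M + 1) ^ 2 ≤ 1) :
    poissonTerm l k ≤ √(l / k) * exp (-(c * poissonScore l k ^ 2)) := by
  have hk' : (0 : ℝ) < k := by positivity
  have hratio : 0 < (k : ℝ) / l := by positivity
  have hentropy : c * poissonScore l k ^ 2 ≤ l * klFun (k / l) := by
    have hkl := sq_sub_one_le_mul_klFun hratio ((div_le_iff₀ hl).2 hkM)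
    have hnonneg := klFun_nonneg hratio.le
    calc c * poissonScore l k ^ 2 = l * (c * (k / l - 1) ^ 2) := by
          rw [poissonScore_sq hl]; ring
      _ ≤ l * (c * ((√M + 1) ^ 2 * klFun (k / l))) := by gcongr
      _ = l * (c * (√M + 1) ^ 2 * klFun (k / l)) := by ring
      _ ≤ l * klFun (k / l) := by gcongr; exact mul_le_of_le_one_left hnonneg hcM
  have hstirling : log √π ≤ log (Stirling.stirlingSeq k) :=
    log_le_log (by positivity) (Stirling.sqrt_pi_le_stirlingSeq hk)
  have hsqrt : log √(l / k) = -(1 / 2) * log (k / l) := by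
    rw [log_sqrt (by positivity), ← inv_div (k : ℝ) l, log_inv]; ring
  rw [← exp_log (poissonTerm_pos hl k), ← exp_log (sqrt_pos.2 (div_pos hl hk')), ← exp_add,
    exp_le_exp, hsqrt, log_poissonTerm hl hk]
  linarith

theorem abs_log_poissonTerm_add_le {l : ℝ} {k : ℕ} (hl : 0 < l) (hnear : |k / l - 1| ≤ 1 / 2) :
    |log (poissonTerm l k) + poissonScore l k ^ 2 / 2| ≤
      (|poissonScore l k| + 4 * |poissonScore l k| ^ 3 + 1 / √l) / √l := by
  set d : ℝ := k / l - 1 with hd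
  have hratio : (k : ℝ) / l = 1 + d := by rw [hd]; ring
  have hkl : l / 2 ≤ k := by
    have : (1 / 2 : ℝ) ≤ k / l := by rw [hratio]; linarith [(abs_le.1 hnear).1]
    linarith [(le_div_iff₀ hl).1 this]
  have hk : k ≠ 0 := by
    rintro rfl
    rw [Nat.cast_zero] at hkl
    linarith
  have hstirling : |log (Stirling.stirlingSeq k) - log √π| ≤ 1 / l := by
    have hlower : log √π ≤ log (Stirling.stirlingSeq k) :=
      log_le_log (by positivity) (Stirling.sqrt_pi_le_stirlingSeq hk)
    have hinv : 1 / (12 * (k : ℝ)) ≤ 1 / l := one_div_le_one_div_of_le hl (by linarith)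
    rw [abs_of_nonneg (sub_nonneg.2 hlower)]
    linarith [log_stirlingSeq_le hk]
  calc |log (poissonTerm l k) + poissonScore l k ^ 2 / 2|
      = |-(1 / 2) * log (1 + d) + -(l * (klFun (1 + d) - d ^ 2 / 2)) +
          -(log (Stirling.stirlingSeq k) - log √π)| := by
        rw [log_poissonTerm hl hk, poissonScore_sq hl, ← hd, hratio]; congr 1; ring
    _ ≤ 1 / 2 * |log (1 + d)| + l * |klFun (1 + d) - d ^ 2 / 2| +
          |log (Stirling.stirlingSeq k) - log √π| := by
        refine (abs_add_three _ _ _).trans_eq ?_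
        rw [abs_mul, abs_neg, abs_neg, abs_neg, abs_mul, abs_of_pos hl, abs_of_pos one_half_pos]
    _ ≤ 1 / 2 * (2 * |d|) + l * (4 * |d| ^ 3) + 1 / l := by
        gcongr
        exacts [abs_log_one_add_le hnear, abs_klFun_one_add_sub_le hnear]
    _ = (|poissonScore l k| + 4 * |poissonScore l k| ^ 3 + 1 / √l) / √l := by
        have hsq : √l ^ 2 = l := sq_sqrt hl.le
        rw [hd, abs_div_sub_one_eq hl]
        field_simp
        linear_combination (√l - 4 * |poissonScore l k| ^ 3 * l) * hsq

theorem abs_poissonTerm_sub_exp_le_of_near {l M b : ℝ} {k : ℕ} (hl : 0 < l) (hkM : k ≤ M * l)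
    (hb : 0 ≤ b) (hbM : b * (√M + 1) ^ 2 ≤ 1) (hb_half : b ≤ 1 / 2)
    (hnear : |k / l - 1| ≤ 1 / 2) :
    |poissonTerm l k - exp (-(poissonScore l k ^ 2 / 2))| ≤
      (|poissonScore l k| + 4 * |poissonScore l k| ^ 3 + 1 / √l) / √l *
        (3 * exp (-(b * poissonScore l k ^ 2))) := by
  set z := poissonScore l k
  have hhalf : (1 / 2 : ℝ) ≤ k / l := by linarith [(abs_le.1 hnear).1]
  have hk : k ≠ 0 := by
    rintro rfl
    norm_num at hhalf
  have hterm : poissonTerm l k ≤ 2 * exp (-(b * z ^ 2)) := by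
    refine (poissonTerm_le hl hk hkM hb hbM).trans ?_
    gcongr
    rw [sqrt_le_left two_pos.le, ← inv_div, inv_le_comm₀ (by positivity) (by norm_num)]
    linarith
  have hgauss : exp (-(z ^ 2 / 2)) ≤ exp (-(b * z ^ 2)) :=
    exp_le_exp.2 (by nlinarith [sq_nonneg z])
  have hexp := abs_exp_sub_exp_le (log (poissonTerm l k)) (-(z ^ 2 / 2))
  rw [exp_log (poissonTerm_pos hl k), sub_neg_eq_add] at hexp
  refine hexp.trans ?_
  have hlog := abs_log_poissonTerm_add_le hl hnear
  have := poissonTerm_pos hl k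
  gcongr
  linarith

theorem abs_poissonTerm_sub_exp_le_of_far {l M b : ℝ} {k : ℕ} (hl : 0 < l) (hk : k ≠ 0)
    (hkM : k ≤ M * l) (hb : 0 ≤ b) (hbM : b * (√M + 1) ^ 2 ≤ 1) (hb_half : b ≤ 1 / 2)
    (hfar : 1 / 2 ≤ |k / l - 1|) :
    |poissonTerm l k - exp (-(poissonScore l k ^ 2 / 2))| ≤
      (1 + 1 / √l) / √l * (4 * poissonScore l k ^ 2 * exp (-(b * poissonScore l k ^ 2))) := by
  set z := poissonScore l k with hz
  have hk1 : (1 : ℝ) ≤ k := by exact_mod_cast Nat.one_le_iff_ne_zero.2 hk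
  have hlz : l ≤ 4 * z ^ 2 := by
    have : (1 / 2 : ℝ) ^ 2 ≤ |(k : ℝ) / l - 1| ^ 2 := by gcongr
    rw [sq_abs] at this
    rw [hz, poissonScore_sq hl]
    nlinarith
  have hterm : poissonTerm l k ≤ √l * exp (-(b * z ^ 2)) := by
    refine (poissonTerm_le hl hk hkM hb hbM).trans ?_
    gcongr
    exact div_le_self hl.le hk1
  have hgauss : exp (-(z ^ 2 / 2)) ≤ exp (-(b * z ^ 2)) :=
    exp_le_exp.2 (by nlinarith [sq_nonneg z])
  calc |poissonTerm l k - exp (-(z ^ 2 / 2))|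
      ≤ poissonTerm l k + exp (-(z ^ 2 / 2)) := by
        refine (abs_sub _ _).trans_eq ?_
        rw [abs_of_pos (poissonTerm_pos hl k), abs_exp]
    _ ≤ √l * exp (-(b * z ^ 2)) + exp (-(b * z ^ 2)) := add_le_add hterm hgauss
    _ = (1 + 1 / √l) / √l * (l * exp (-(b * z ^ 2))) := by
        field_simp
        rw [sq_sqrt hl.le]
    _ ≤ (1 + 1 / √l) / √l * (4 * z ^ 2 * exp (-(b * z ^ 2))) := by gcongr

theorem exists_abs_poissonTerm_sub_exp_le (M : ℝ) {l₀ : ℝ} (hl₀ : 0 < l₀) :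
    ∃ C : ℝ, 0 ≤ C ∧ ∃ c : ℝ, 0 < c ∧ c ≤ 1 / 2 ∧ ∀ (l : ℝ) (k : ℕ),
      l₀ ≤ l → k ≠ 0 → k ≤ M * l →
      |poissonTerm l k - exp (-(poissonScore l k ^ 2 / 2))| ≤
        C / √l * exp (-(c * poissonScore l k ^ 2)) := by
  set b : ℝ := 1 / (2 * (√M + 1) ^ 2)
  have hb : 0 < b := by positivity
  have hbM : b * (√M + 1) ^ 2 ≤ 1 := by
    simp only [b]
    field_simp
    norm_num
  have hb_half : b ≤ 1 / 2 :=
    one_div_le_one_div_of_le two_pos (by nlinarith [sqrt_nonneg M])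
  set c := b / 2 with hc
  have hcpos : 0 < c := by positivity
  have hsplit (z : ℝ) : exp (-(b * z ^ 2)) = exp (-(c * z ^ 2)) * exp (-(c * z ^ 2)) := by
    rw [← exp_add, hc]; ring_nf
  set B : ℕ → ℝ := fun m => 1 + m.factorial / c ^ m
  have hB (m : ℕ) (z : ℝ) : |z| ^ m * exp (-(c * z ^ 2)) ≤ B m :=
    abs_pow_mul_exp_neg_mul_sq_le m hcpos z
  set K := 1 / √l₀
  refine ⟨3 * (B 1 + 4 * B 3 + K * B 0) + (1 + K) * (4 * B 2), by positivity, c, hcpos,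
    by linarith, fun l k hl hk hkM => ?_⟩
  have hlpos : 0 < l := hl₀.trans_le hl
  have hK : 1 / √l ≤ K := one_div_le_one_div_of_le (sqrt_pos.2 hl₀) (sqrt_le_sqrt hl)
  set z := poissonScore l k
  set e := exp (-(c * z ^ 2))
  rcases le_total |(k : ℝ) / l - 1| (1 / 2) with hnear | hfar
  · calc |poissonTerm l k - exp (-(z ^ 2 / 2))|
        ≤ (|z| + 4 * |z| ^ 3 + 1 / √l) / √l * (3 * exp (-(b * z ^ 2))) :=
          abs_poissonTerm_sub_exp_le_of_near hlpos hkM hb.le hbM hb_half hnear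
      _ = 3 * (|z| ^ 1 * e + 4 * (|z| ^ 3 * e) + 1 / √l * (|z| ^ 0 * e)) / √l * e := by
          rw [hsplit]; ring
      _ ≤ 3 * (B 1 + 4 * B 3 + K * B 0) / √l * e := by gcongr <;> exact hB _ z
      _ ≤ _ := by gcongr; exact le_add_of_nonneg_right (by positivity)
  · calc |poissonTerm l k - exp (-(z ^ 2 / 2))|
        ≤ (1 + 1 / √l) / √l * (4 * z ^ 2 * exp (-(b * z ^ 2))) :=
          abs_poissonTerm_sub_exp_le_of_far hlpos hk hkM hb.le hbM hb_half hfar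
      _ = (1 + 1 / √l) * (4 * (|z| ^ 2 * e)) / √l * e := by rw [hsplit, sq_abs]; ring
      _ ≤ (1 + K) * (4 * B 2) / √l * e := by gcongr; exact hB 2 z
      _ ≤ _ := by gcongr; exact le_add_of_nonneg_left (by positivity)

end Poisson

section CountWeight

open Real

/-! ### The local limit theorem for products of Poisson weights -/

theorem abs_prod_le_of_abs_sub_le {ι : Type*} (s : Finset ι) {a b e : ι → ℝ} {η κ : ℝ}
    (hηκ : η ≤ κ) (hb : ∀ i ∈ s, |b i| ≤ e i) (hab : ∀ i ∈ s, |a i - b i| ≤ η * e i) :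
    |∏ i ∈ s, a i| ≤ (1 + κ) ^ s.card * ∏ i ∈ s, e i := by
  rw [Finset.abs_prod, ← Finset.prod_const, ← Finset.prod_mul_distrib]
  refine Finset.prod_le_prod (fun _ _ => abs_nonneg _) fun i hi => ?_
  have htriangle : |a i| ≤ |b i| + |a i - b i| := by
    simpa only [add_sub_cancel] using abs_add_le (b i) (a i - b i)
  nlinarith [hb i hi, hab i hi, (abs_nonneg _).trans (hb i hi)]

theorem abs_prod_sub_prod_le {ι : Type*} (s : Finset ι) {a b e : ι → ℝ} {η κ : ℝ} (hη : 0 ≤ η)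
    (hηκ : η ≤ κ) (hb : ∀ i ∈ s, |b i| ≤ e i) (hab : ∀ i ∈ s, |a i - b i| ≤ η * e i) :
    |∏ i ∈ s, a i - ∏ i ∈ s, b i| ≤ η * (s.card * (1 + κ) ^ s.card * ∏ i ∈ s, e i) := by
  classical
  induction s using Finset.induction_on with
  | empty => simp
  | insert i s his ih =>
    rw [Finset.forall_mem_insert] at hb hab
    have hA := abs_prod_le_of_abs_sub_le s hηκ hb.2 hab.2
    have hei : 0 ≤ e i := (abs_nonneg _).trans hb.1
    have hE : 0 ≤ ∏ i ∈ s, e i :=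
      Finset.prod_nonneg fun j hj => (abs_nonneg _).trans (hb.2 j hj)
    rw [Finset.prod_insert his, Finset.prod_insert his, Finset.prod_insert his,
      Finset.card_insert_of_notMem his]
    set A := ∏ i ∈ s, a i
    set B := ∏ i ∈ s, b i
    set E := ∏ i ∈ s, e i
    calc |a i * A - b i * B| = |(a i - b i) * A + b i * (A - B)| := by congr 1; ring
      _ ≤ |a i - b i| * |A| + |b i| * |A - B| := by
          refine (abs_add_le _ _).trans_eq ?_
          rw [abs_mul, abs_mul]
      _ ≤ η * e i * ((1 + κ) ^ s.card * E) +
            e i * (η * (s.card * (1 + κ) ^ s.card * E)) := by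
          gcongr
          exacts [hab.1, hb.1, ih hb.2 hab.2]
      _ = η * (((s.card + 1 : ℕ) : ℝ) * (1 + κ) ^ s.card * (e i * E)) := by push_cast; ring
      _ ≤ η * (((s.card + 1 : ℕ) : ℝ) * (1 + κ) ^ (s.card + 1) * (e i * E)) := by
          gcongr
          · linarith
          · omega

variable {𝒳 : Type*} [Fintype 𝒳]

/-- The multinomial weight of the vector of counts `N`, up to a factor that depends only on the
number of observations. It vanishes unless all counts are positive, because the empirical type of
the sample must lie in the open simplex. -/
def countWeight (P : 𝒳 → ℝ) (n : ℕ) (N : 𝒳 → ℤ) : ℝ :=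
  open Classical in if ∀ x, 0 < N x then ∏ x, poissonTerm (n * P x) (N x).toNat else 0

/-- The deviation of the counts `N` from their means `n P`, with every coordinate in units of the
corresponding Poisson standard deviation. -/
def scaledDeviation (P : 𝒳 → ℝ) (n : ℕ) (N : 𝒳 → ℤ) : EuclideanSpace ℝ 𝒳 :=
  WithLp.toLp 2 fun x => poissonScore (n * P x) (N x)

theorem norm_sq_scaledDeviation (P : 𝒳 → ℝ) (n : ℕ) (N : 𝒳 → ℤ) :
    ‖scaledDeviation P n N‖ ^ 2 = ∑ x, poissonScore (n * P x) (N x) ^ 2 := by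
  simp only [EuclideanSpace.norm_sq_eq, scaledDeviation, Real.norm_eq_abs, sq_abs]

theorem countWeight_nonneg {P : 𝒳 → ℝ} (hP : ∀ x, 0 < P x) {n : ℕ} (hn : n ≠ 0) (N : 𝒳 → ℤ) :
    0 ≤ countWeight P n N := by
  unfold countWeight
  split_ifs
  · exact Finset.prod_nonneg fun x _ => (poissonTerm_pos (by have := hP x; positivity) _).le
  · exact le_rfl

theorem exists_abs_prod_poissonTerm_sub_exp_le {P : 𝒳 → ℝ} {p : ℝ} (hp : 0 < p)
    (hP : ∀ x, p ≤ P x) :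
    ∃ C : ℝ, 0 ≤ C ∧ ∃ c : ℝ, 0 < c ∧ c ≤ 1 / 2 ∧ ∀ (n : ℕ) (N : 𝒳 → ℤ), n ≠ 0 →
      (∀ x, 0 < N x) → ∑ x, N x = n →
      |∏ x, poissonTerm (n * P x) (N x).toNat - exp (-(‖scaledDeviation P n N‖ ^ 2 / 2))| ≤
        C / √n * exp (-(c * ‖scaledDeviation P n N‖ ^ 2)) := by
  obtain ⟨C, hC, c, hc, hc_half, hpoisson⟩ := exists_abs_poissonTerm_sub_exp_le (1 / p) hp
  set κ := C / √p
  set m := Fintype.card 𝒳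
  refine ⟨κ * (m * (1 + κ) ^ m), by positivity, c, hc, hc_half, fun n N hn hpos hsum => ?_⟩
  have hn1 : (1 : ℝ) ≤ n := by exact_mod_cast Nat.one_le_iff_ne_zero.2 hn
  have hterm (x : 𝒳) : |poissonTerm (n * P x) (N x).toNat -
      exp (-(poissonScore (n * P x) (N x) ^ 2 / 2))| ≤
        κ / √n * exp (-(c * poissonScore (n * P x) (N x) ^ 2)) := by
    have hPx := hP x
    have hcast : (((N x).toNat : ℕ) : ℝ) = N x := by
      exact_mod_cast Int.toNat_of_nonneg (hpos x).le
    have hNn : (N x : ℝ) ≤ n := by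
      exact_mod_cast hsum ▸ Finset.single_le_sum (fun y _ => (hpos y).le) (Finset.mem_univ x)
    have hbound := hpoisson (n * P x) (N x).toNat (by nlinarith) (by have := hpos x; omega) (by
      rw [hcast, one_div_mul_eq_div, le_div_iff₀ hp]
      gcongr)
    rw [hcast] at hbound
    refine hbound.trans ?_
    rw [div_div, ← sqrt_mul hp.le, mul_comm p]
    gcongr
  have hprod := abs_prod_sub_prod_le Finset.univ (η := κ / √n) (κ := κ) (by positivity)
    (div_le_self (by positivity) (one_le_sqrt.2 hn1))
    (e := fun x => exp (-(c * poissonScore (n * P x) (N x) ^ 2)))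
    (fun x _ => by
      rw [abs_exp, exp_le_exp]
      nlinarith [sq_nonneg (poissonScore (n * P x) (N x))])
    (fun x _ => hterm x)
  simp only [← exp_sum, Finset.sum_neg_distrib, ← Finset.sum_div, ← Finset.mul_sum,
    ← norm_sq_scaledDeviation] at hprod
  refine hprod.trans_eq ?_
  rw [Finset.card_univ]
  ring

theorem mul_le_norm_sq_scaledDeviation {P : 𝒳 → ℝ} {n : ℕ} {N : 𝒳 → ℤ} {x : 𝒳} (hPx : 0 ≤ P x)
    (hx : N x ≤ 0) : n * P x ≤ ‖scaledDeviation P n N‖ ^ 2 := by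
  have hNx : (N x : ℝ) ≤ 0 := by exact_mod_cast hx
  have hl : 0 ≤ n * P x := by positivity
  calc (n * P x : ℝ) ≤ poissonScore (n * P x) (N x) ^ 2 := by
        rw [poissonScore, div_pow, sq_sqrt hl]
        rcases hl.eq_or_lt with h | h
        · simp [← h]
        · rw [le_div_iff₀ h]
          nlinarith
    _ ≤ ‖scaledDeviation P n N‖ ^ 2 := by
        rw [norm_sq_scaledDeviation]
        exact Finset.single_le_sum (f := fun x => poissonScore (n * P x) (N x) ^ 2)
          (fun _ _ => sq_nonneg _) (Finset.mem_univ x)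

theorem exp_neg_norm_sq_scaledDeviation_le {P : 𝒳 → ℝ} {p : ℝ} (hp : 0 < p) (hP : ∀ x, p ≤ P x)
    {n : ℕ} (hn : n ≠ 0) {N : 𝒳 → ℤ} {x : 𝒳} (hx : N x ≤ 0) :
    exp (-(‖scaledDeviation P n N‖ ^ 2 / 2)) ≤
      4 / p / √n * exp (-(1 / 4 * ‖scaledDeviation P n N‖ ^ 2)) := by
  have hn1 : (1 : ℝ) ≤ n := by exact_mod_cast Nat.one_le_iff_ne_zero.2 hn
  have hmean := mul_le_norm_sq_scaledDeviation (n := n) (hp.le.trans (hP x)) hx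
  set t := ‖scaledDeviation P n N‖ ^ 2
  have hpt : p * √n ≤ t := by
    have hsqrt : √(n : ℝ) ≤ n := by
      rw [sqrt_le_left (by linarith)]
      nlinarith
    calc p * √n ≤ P x * n := by gcongr; exacts [hp.le.trans (hP x), hP x]
      _ ≤ t := by rwa [mul_comm]
  have hdecay : t * exp (-(1 / 4 * t)) ≤ 4 := by
    have := pow_mul_exp_neg_mul_le 1 (c := 1 / 4) (by norm_num) (sq_nonneg ‖scaledDeviation P n N‖)
    norm_num at this ⊢
    exact this
  have hsplit : exp (-(t / 2)) = exp (-(1 / 4 * t)) * exp (-(1 / 4 * t)) := by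
    rw [← exp_add]
    ring_nf
  rw [hsplit, div_div]
  gcongr
  rw [le_div_iff₀ (by positivity), mul_comm]
  exact (mul_le_mul_of_nonneg_right hpt (exp_pos _).le).trans hdecay

theorem exists_abs_countWeight_sub_exp_le {P : 𝒳 → ℝ} (hP : ∀ x, 0 < P x) :
    ∃ C : ℝ, 0 ≤ C ∧ ∃ c : ℝ, 0 < c ∧ c ≤ 1 / 2 ∧ ∀ (n : ℕ) (N : 𝒳 → ℤ), n ≠ 0 →
      ∑ x, N x = n →
      |countWeight P n N - exp (-(‖scaledDeviation P n N‖ ^ 2 / 2))| ≤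
        C / √n * exp (-(c * ‖scaledDeviation P n N‖ ^ 2)) := by
  obtain ⟨p, hp, hpP⟩ : ∃ p, 0 < p ∧ ∀ x, p ≤ P x := by
    cases isEmpty_or_nonempty 𝒳
    · exact ⟨1, one_pos, isEmptyElim⟩
    · obtain ⟨x, hx⟩ := Finite.exists_min P
      exact ⟨P x, hP x, hx⟩
  obtain ⟨C, -, c, hc, hc_half, hprod⟩ := exists_abs_prod_poissonTerm_sub_exp_le hp hpP
  refine ⟨max C (4 / p), by positivity, c / 2, by positivity, by linarith, fun n N hn hsum => ?_⟩
  by_cases hpos : ∀ x, 0 < N x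
  · rw [countWeight, if_pos hpos]
    refine (hprod n N hn hpos hsum).trans ?_
    gcongr
    exacts [le_max_left _ _, half_le_self hc.le]
  · rw [countWeight, if_neg hpos, zero_sub, abs_neg, abs_exp]
    push Not at hpos
    obtain ⟨x, hx⟩ := hpos
    refine (exp_neg_norm_sq_scaledDeviation_le hp hpP hn hx).trans ?_
    gcongr ?_ / _ * exp (-(?_ * _))
    exacts [le_max_right _ _, by linarith]

end CountWeight

section Lattice

open Module
open scoped Pointwise

/-! ### Gaussian sums over lattices -/

theorem exists_mem_lattice_norm_add_le {E : Type*} [NormedAddCommGroup E] [NormedSpace ℝ E]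
    [FiniteDimensional ℝ E] (L : Submodule ℤ E) [DiscreteTopology L] [IsZLattice ℝ L] :
    ∃ D : ℝ, ∀ x : E, ∃ l ∈ L, ‖x + l‖ ≤ D := by
  set b := (Free.chooseBasis ℤ L).ofZLatticeBasis ℝ
  obtain ⟨D, hD⟩ := (ZSpan.fundamentalDomain_isBounded b).exists_norm_le
  refine ⟨D, fun x => ⟨-(ZSpan.floor b x : E), L.neg_mem ?_, ?_⟩⟩
  · exact (Basis.ofZLatticeBasis_span ℝ L (Free.chooseBasis ℤ L)).le (ZSpan.floor b x).2
  · rw [← sub_eq_add_neg]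
    exact hD _ (ZSpan.fract_mem_fundamentalDomain b x)

theorem abs_measureReal_mul_tsum_sub_integral_le {E : Type*} [NormedAddCommGroup E]
    [MeasurableSpace E] [BorelSpace E] {μ : Measure E} [μ.IsAddLeftInvariant]
    {L : Submodule ℤ E} [Countable L] {F : Set E} (hF : IsAddFundamentalDomain L F μ)
    (hF₀ : μ F ≠ 0) (hF_top : μ F ≠ ⊤) {f g : E → ℝ} (hf : Integrable f μ) (hg : Integrable g μ)
    (hfg : ∀ l ∈ L, ∀ y ∈ F, |f (l + y) - f l| ≤ g (l + y)) :
    Summable (fun l : L => f l) ∧ |μ.real F * ∑' l : L, f l - ∫ x, f x ∂μ| ≤ ∫ x, g x ∂μ := by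
  have : VAddInvariantMeasure L E μ := ⟨fun c s _ => measure_preimage_add μ (c : E) s⟩
  have hcells {h : E → ℝ} (hh : Integrable h μ) :
      HasSum (fun l : L => ∫ x in l +ᵥ F, h x ∂μ) (∫ x, h x ∂μ) := by
    have := hasSum_integral_measure (μ := fun l : L => μ.restrict (l +ᵥ F))
      (by rwa [hF.sum_restrict])
    rwa [hF.sum_restrict] at this
  have hcell (l : L) :
      |∫ x in l +ᵥ F, f x ∂μ - μ.real F * f l| ≤ ∫ x in l +ᵥ F, g x ∂μ := by
    have hvol : μ (l +ᵥ F) = μ F := measure_vadd μ l F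
    have hconst : ∫ _ in l +ᵥ F, f l ∂μ = μ.real F * f l := by
      rw [setIntegral_const, measureReal_def, measureReal_def, hvol, smul_eq_mul]
    rw [← hconst, ← integral_sub hf.integrableOn (integrableOn_const (hvol ▸ hF_top)),
      ← Real.norm_eq_abs]
    refine norm_integral_le_of_norm_le hg.integrableOn ?_
    refine (ae_restrict_iff'₀ (hF.nullMeasurableSet_vadd l)).2 (.of_forall ?_)
    rintro _ ⟨y, hy, rfl⟩
    exact hfg l l.2 y hy
  have hdiff : Summable fun l : L => ∫ x in l +ᵥ F, f x ∂μ - μ.real F * f l :=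
    .of_norm_bounded (hcells hg).summable hcell
  have hvol_ne : μ.real F ≠ 0 := (ENNReal.toReal_pos hF₀ hF_top).ne'
  have hsum : Summable fun l : L => f l := by
    have := (hcells hf).summable.sub hdiff
    simp only [sub_sub_cancel] at this
    exact (summable_mul_left_iff hvol_ne).1 this
  refine ⟨hsum, ?_⟩
  rw [← (hcells hf).tsum_eq, ← tsum_mul_left, abs_sub_comm,
    ← (hcells hf).summable.tsum_sub (hsum.mul_left _), ← Real.norm_eq_abs]
  exact tsum_of_norm_bounded (hcells hg) hcell

theorem exists_abs_exp_neg_mul_norm_sq_sub_le (E : Type*) [NormedAddCommGroup E] {b : ℝ}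
    (hb : 0 < b) (D : ℝ) :
    ∃ K : ℝ, 0 ≤ K ∧ ∀ x y : E, ‖x - y‖ ≤ D →
      |Real.exp (-(b * ‖x‖ ^ 2)) - Real.exp (-(b * ‖y‖ ^ 2))| ≤
        ‖x - y‖ * (K * Real.exp (-(b / 4 * ‖y‖ ^ 2))) := by
  have hb4 : 0 < b / 4 := by positivity
  set B : ℝ := 1 + 1 / (b / 4)
  refine ⟨b * (2 * B + |D|) * (Real.exp (b * D ^ 2) + 1), by positivity, fun x y hxy => ?_⟩
  have hx := norm_nonneg x
  have hy := norm_nonneg y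
  obtain ⟨hlower, hupper⟩ := abs_le.1 (abs_norm_sub_norm_le x y)
  set e := Real.exp (-(b / 4 * ‖y‖ ^ 2))
  have he1 : e ≤ 1 := Real.exp_le_one_iff.2 (by rw [neg_nonpos]; positivity)
  have hsplit : Real.exp (-(b / 2 * ‖y‖ ^ 2)) = e * e := by
    rw [← Real.exp_add]
    ring_nf
  have hexpx : Real.exp (-(b * ‖x‖ ^ 2)) ≤ Real.exp (b * D ^ 2) * (e * e) := by
    rw [← hsplit, ← Real.exp_add, Real.exp_le_exp]
    have : ‖y‖ ^ 2 ≤ 2 * ‖x‖ ^ 2 + 2 * D ^ 2 := by nlinarith [sq_nonneg (‖x‖ - D)]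
    nlinarith
  have hexpy : Real.exp (-(b * ‖y‖ ^ 2)) ≤ e * e := by
    rw [← hsplit, Real.exp_le_exp]
    nlinarith [sq_nonneg ‖y‖]
  have hexponent : |-(b * ‖x‖ ^ 2) - -(b * ‖y‖ ^ 2)| ≤ ‖x - y‖ * (b * (2 * ‖y‖ + |D|)) := by
    calc |-(b * ‖x‖ ^ 2) - -(b * ‖y‖ ^ 2)|
        = |-(b * ((‖x‖ - ‖y‖) * (‖x‖ + ‖y‖)))| := by congr 1; ring
      _ = |‖x‖ - ‖y‖| * (b * (‖x‖ + ‖y‖)) := by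
          rw [abs_neg, abs_mul, abs_mul, abs_of_pos hb, abs_of_nonneg (add_nonneg hx hy)]
          ring
      _ ≤ ‖x - y‖ * (b * (2 * ‖y‖ + |D|)) := by
          have hsum : ‖x‖ + ‖y‖ ≤ 2 * ‖y‖ + |D| := by linarith [le_abs_self D]
          exact mul_le_mul (abs_norm_sub_norm_le x y)
            (mul_le_mul_of_nonneg_left hsum hb.le) (by positivity) (norm_nonneg _)
  have hpoly : (2 * ‖y‖ + |D|) * e ≤ 2 * B + |D| := by
    have hye : ‖y‖ * e ≤ B := by
      simpa only [pow_one, abs_norm, Nat.factorial_one, Nat.cast_one] using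
        abs_pow_mul_exp_neg_mul_sq_le 1 hb4 ‖y‖
    linarith [mul_le_of_le_one_right (abs_nonneg D) he1]
  calc |Real.exp (-(b * ‖x‖ ^ 2)) - Real.exp (-(b * ‖y‖ ^ 2))|
      ≤ ‖x - y‖ * (b * (2 * ‖y‖ + |D|)) * (Real.exp (b * D ^ 2) * (e * e) + e * e) :=
        (abs_exp_sub_exp_le _ _).trans (by gcongr)
    _ = ‖x - y‖ * (b * ((2 * ‖y‖ + |D|) * e) * (Real.exp (b * D ^ 2) + 1) * e) := by ring
    _ ≤ ‖x - y‖ * (b * (2 * B + |D|) * (Real.exp (b * D ^ 2) + 1) * e) := by gcongr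

theorem norm_inv_smul_add_sub_le {E : Type*} [NormedAddCommGroup E] [NormedSpace ℝ E] {t D : ℝ}
    (ht : 0 ≤ t) {x y : E} (hy : ‖y‖ ≤ D) (a : E) :
    ‖t⁻¹ • (x + a) - t⁻¹ • (x + y + a)‖ ≤ D / t := by
  rw [← smul_sub, add_sub_add_right_eq_sub, sub_add_cancel_left, norm_smul, norm_neg, norm_inv,
    Real.norm_of_nonneg ht, ← div_eq_inv_mul]
  gcongr

section Gaussian

variable {E : Type*} [NormedAddCommGroup E] [InnerProductSpace ℝ E] [FiniteDimensional ℝ E]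

theorem integral_exp_neg_mul_norm_sq_pos [MeasurableSpace E] [BorelSpace E] {b : ℝ} (hb : 0 < b) :
    0 < ∫ x : E, Real.exp (-(b * ‖x‖ ^ 2)) := by
  have := GaussianFourier.integral_rexp_neg_mul_sq_norm (V := E) hb
  simp only [neg_mul] at this
  rw [this]
  have := Real.pi_pos
  positivity

theorem integrable_exp_neg_mul_norm_sq [MeasurableSpace E] [BorelSpace E] {b : ℝ} (hb : 0 < b) :
    Integrable fun x : E => Real.exp (-(b * ‖x‖ ^ 2)) :=
  .of_integral_ne_zero (integral_exp_neg_mul_norm_sq_pos hb).ne'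

theorem integral_comp_inv_smul_add [MeasurableSpace E] [BorelSpace E] (h : E → ℝ) {t : ℝ}
    (ht : 0 ≤ t) (a : E) : ∫ x, h (t⁻¹ • (x + a)) = t ^ finrank ℝ E * ∫ x, h x := by
  rw [integral_add_right_eq_self (fun x => h (t⁻¹ • x)) a,
    Measure.integral_comp_inv_smul_of_nonneg volume h ht, smul_eq_mul]

theorem exists_abs_tsum_exp_neg_mul_norm_sq_sub_le (L : Submodule ℤ E) [DiscreteTopology L]
    [IsZLattice ℝ L] {b : ℝ} (hb : 0 < b) :
    ∃ I : ℝ, 0 < I ∧ ∃ C : ℝ, 0 ≤ C ∧ ∀ t : ℝ, 1 ≤ t → ∀ a : E,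
      Summable (fun l : L => Real.exp (-(b * ‖t⁻¹ • ((l : E) + a)‖ ^ 2))) ∧
      |∑' l : L, Real.exp (-(b * ‖t⁻¹ • ((l : E) + a)‖ ^ 2)) - t ^ finrank ℝ E * I| ≤
        C / t * t ^ finrank ℝ E := by
  let _ : MeasurableSpace E := borel E
  have : BorelSpace E := ⟨rfl⟩
  set basis := (Free.chooseBasis ℤ L).ofZLatticeBasis ℝ
  set F := ZSpan.fundamentalDomain basis
  have hF : IsAddFundamentalDomain L F volume :=
    ZLattice.isAddFundamentalDomain (Free.chooseBasis ℤ L) volume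
  have hF₀ : volume F ≠ 0 := ZSpan.measure_fundamentalDomain_ne_zero basis
  have hF_top : volume F ≠ ⊤ := (ZSpan.fundamentalDomain_isBounded basis).measure_lt_top.ne
  obtain ⟨D, hD⟩ := (ZSpan.fundamentalDomain_isBounded basis).exists_norm_le
  obtain ⟨K, hK, hlip⟩ := exists_abs_exp_neg_mul_norm_sq_sub_le E hb |D|
  set γ : ℝ → E → ℝ := fun b x => Real.exp (-(b * ‖x‖ ^ 2))
  have hb4 : 0 < b / 4 := by positivity
  have hvol : 0 < volume.real F := ENNReal.toReal_pos hF₀ hF_top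
  refine ⟨(∫ x, γ b x) / volume.real F, div_pos (integral_exp_neg_mul_norm_sq_pos hb) hvol,
    |D| * K * (∫ x, γ (b / 4) x) / volume.real F, ?_, fun t ht a => ?_⟩
  · have := integral_exp_neg_mul_norm_sq_pos (E := E) hb4
    positivity
  have ht₀ : 0 < t := one_pos.trans_le ht
  have hintegrable {b : ℝ} (hb : 0 < b) : Integrable fun x : E => γ b (t⁻¹ • (x + a)) :=
    ((integrable_exp_neg_mul_norm_sq hb).comp_smul (inv_ne_zero ht₀.ne')).comp_add_right a
  obtain ⟨hsummable, hsum⟩ := abs_measureReal_mul_tsum_sub_integral_le hF hF₀ hF_top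
    (hintegrable hb) ((hintegrable hb4).const_mul (|D| / t * K)) fun l _ y hy => by
      have hstep : ‖t⁻¹ • (l + a) - t⁻¹ • (l + y + a)‖ ≤ |D| / t :=
        norm_inv_smul_add_sub_le ht₀.le ((hD y hy).trans (le_abs_self D)) a
      rw [abs_sub_comm, mul_assoc]
      refine (hlip _ _ (hstep.trans (div_le_self (abs_nonneg D) ht))).trans ?_
      gcongr
  refine ⟨hsummable, ?_⟩
  rw [integral_comp_inv_smul_add (γ b) ht₀.le, integral_const_mul,
    integral_comp_inv_smul_add (γ (b / 4)) ht₀.le] at hsum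
  rw [← mul_le_mul_iff_of_pos_left hvol]
  calc volume.real F * |∑' l : L, γ b (t⁻¹ • ((l : E) + a)) -
        t ^ finrank ℝ E * ((∫ x, γ b x) / volume.real F)|
      = |volume.real F * ∑' l : L, γ b (t⁻¹ • ((l : E) + a)) -
          t ^ finrank ℝ E * ∫ x, γ b x| := by
        rw [← abs_of_pos hvol, ← abs_mul, abs_of_pos hvol]
        congr 1
        field_simp
    _ ≤ |D| / t * K * (t ^ finrank ℝ E * ∫ x, γ (b / 4) x) := hsum
    _ = _ := by field_simp

end Gaussian

end Lattice

section Whitening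

open Module

/-! ### Lattices of integer vectors -/

variable {𝒳 : Type*}

/-- An integer vector, regarded as a real vector. -/
def castVector : (𝒳 → ℤ) →+ (𝒳 → ℝ) := (Int.castAddHom ℝ).compLeft 𝒳

@[simp]
theorem castVector_apply (z : 𝒳 → ℤ) (x : 𝒳) : castVector z x = z x := rfl

theorem castVector_injective : Function.Injective (castVector (𝒳 := 𝒳)) :=
  fun _ _ h => funext fun x => Int.cast_injective (congrFun h x)

/-- The lattice of integer vectors in a subspace. -/
def integerVectors (S : Submodule ℝ (𝒳 → ℝ)) : AddSubgroup (𝒳 → ℤ) :=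
  S.toAddSubgroup.comap castVector

theorem mem_integerVectors {S : Submodule ℝ (𝒳 → ℝ)} {z : 𝒳 → ℤ} :
    z ∈ integerVectors S ↔ castVector z ∈ S := Iff.rfl

/-- Division of the coordinates by the standard deviations `√(P x)`. It carries the information
metric at `P` to the Euclidean metric. -/
def whiten (P : 𝒳 → ℝ) : (𝒳 → ℝ) →ₗ[ℝ] EuclideanSpace ℝ 𝒳 where
  toFun v := WithLp.toLp 2 fun x => v x / √(P x)
  map_add' v w := by ext x; simp [add_div]
  map_smul' c v := by ext x; simp [mul_div_assoc]

@[simp]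
theorem whiten_apply (P v : 𝒳 → ℝ) (x : 𝒳) : whiten P v x = v x / √(P x) := rfl

theorem whiten_injective {P : 𝒳 → ℝ} (hP : ∀ x, 0 < P x) : Function.Injective (whiten P) := by
  intro v w h
  ext x
  have hx : v x / √(P x) = w x / √(P x) := congrFun (congrArg WithLp.ofLp h) x
  exact (div_left_inj' (Real.sqrt_pos.2 (hP x)).ne').1 hx

/-- Whitening of the integer vectors in a subspace. -/
def whitenInt (P : 𝒳 → ℝ) (S : Submodule ℝ (𝒳 → ℝ)) : integerVectors S →+ S.map (whiten P) :=
  (((whiten P).toAddMonoidHom.comp castVector).comp (integerVectors S).subtype).codRestrict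
    (S.map (whiten P)) fun z => ⟨_, z.2, rfl⟩

@[simp]
theorem coe_whitenInt (P : 𝒳 → ℝ) (S : Submodule ℝ (𝒳 → ℝ)) (z : integerVectors S) :
    (whitenInt P S z : EuclideanSpace ℝ 𝒳) = whiten P (castVector z) := rfl

theorem whitenInt_injective {P : 𝒳 → ℝ} (hP : ∀ x, 0 < P x) (S : Submodule ℝ (𝒳 → ℝ)) :
    Function.Injective (whitenInt P S) := fun _ _ h =>
  Subtype.ext (castVector_injective (whiten_injective hP (congrArg Subtype.val h)))

/-- The image of the integer vectors in `S`, as a lattice in the whitening of `S`. -/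
def whitenedLattice (P : 𝒳 → ℝ) (S : Submodule ℝ (𝒳 → ℝ)) : Submodule ℤ (S.map (whiten P)) :=
  (whitenInt P S).range.toIntSubmodule

theorem span_whitenedLattice [Finite 𝒳] (P : 𝒳 → ℝ) {S : Submodule ℝ (𝒳 → ℝ)}
    (hS : SpannedByIntegerVectors S) :
    Submodule.span ℝ (whitenedLattice P S : Set (S.map (whiten P))) = ⊤ := by
  have himage : Subtype.val '' (whitenedLattice P S : Set (S.map (whiten P))) =
      whiten P '' {v | v ∈ S ∧ ∀ x, ∃ z : ℤ, v x = z} := by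
    ext w
    constructor
    · rintro ⟨_, ⟨z, rfl⟩, rfl⟩
      exact ⟨castVector z, ⟨z.2, fun x => ⟨z.1 x, rfl⟩⟩, rfl⟩
    · rintro ⟨v, ⟨hv, hint⟩, rfl⟩
      choose z hz using hint
      obtain rfl : v = castVector z := funext hz
      exact ⟨_, ⟨⟨z, hv⟩, rfl⟩, rfl⟩
  apply Submodule.map_injective_of_injective (S.map (whiten P)).injective_subtype
  rw [Submodule.map_span, Submodule.coe_subtype, himage, ← Submodule.map_span, hS,
    Submodule.map_subtype_top]

theorem scaledDeviation_eq (P : 𝒳 → ℝ) (n : ℕ) (N : 𝒳 → ℤ) :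
    scaledDeviation P n N = (√n)⁻¹ • whiten P (castVector N - (n : ℝ) • P) := by
  ext x
  simp only [scaledDeviation, poissonScore, PiLp.smul_apply, whiten_apply, smul_eq_mul,
    Pi.sub_apply, Pi.smul_apply, castVector_apply, Real.sqrt_mul (Nat.cast_nonneg n)]
  field_simp

theorem scaledDeviation_add (P : 𝒳 → ℝ) (n : ℕ) (N z : 𝒳 → ℤ) :
    scaledDeviation P n (N + z) =
      scaledDeviation P n N + (√n)⁻¹ • whiten P (castVector z) := by
  rw [scaledDeviation_eq, scaledDeviation_eq, ← smul_add, ← map_add, map_add castVector,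
    sub_add_eq_add_sub]

variable [Fintype 𝒳]

theorem norm_sq_whiten {P : 𝒳 → ℝ} (hP : ∀ x, 0 ≤ P x) (v : 𝒳 → ℝ) :
    ‖whiten P v‖ ^ 2 = ∑ x, v x ^ 2 / P x := by
  simp only [EuclideanSpace.norm_sq_eq, Real.norm_eq_abs, sq_abs, whiten_apply, div_pow,
    Real.sq_sqrt (hP _)]

theorem one_le_norm_whiten {P : 𝒳 → ℝ} (hP : P ∈ openSimplex 𝒳) {z : 𝒳 → ℤ} (hz : z ≠ 0) :
    1 ≤ ‖whiten P (castVector z)‖ := by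
  obtain ⟨x, hx⟩ := Function.ne_iff.1 hz
  have hPx : P x ≤ 1 := hP.2 ▸ Finset.single_le_sum (fun y _ => (hP.1 y).le) (Finset.mem_univ x)
  have hzx : (1 : ℝ) ≤ |(z x : ℝ)| := by exact_mod_cast Int.one_le_abs hx
  refine le_trans ?_ (PiLp.norm_apply_le _ x)
  rw [whiten_apply, castVector_apply, Real.norm_eq_abs, abs_div, abs_of_nonneg (Real.sqrt_nonneg _),
    one_le_div (Real.sqrt_pos.2 (hP.1 x))]
  exact (Real.sqrt_le_one.2 hPx).trans hzx

theorem discreteTopology_whitenedLattice {P : 𝒳 → ℝ} (hP : P ∈ openSimplex 𝒳)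
    (S : Submodule ℝ (𝒳 → ℝ)) : DiscreteTopology (whitenedLattice P S) := by
  refine DiscreteTopology.of_forall_le_dist one_pos ?_
  rintro ⟨_, z, rfl⟩ ⟨_, y, rfl⟩ hne
  have hzy : (z - y : 𝒳 → ℤ) ≠ 0 := fun h => hne (by rw [Subtype.ext (sub_eq_zero.1 h)])
  have hnorm := one_le_norm_whiten hP hzy
  rwa [map_sub, map_sub, ← dist_eq_norm] at hnorm

theorem exists_integerVector_norm_le {P : 𝒳 → ℝ} (hP : P ∈ openSimplex 𝒳)
    {S : Submodule ℝ (𝒳 → ℝ)} (hS : SpannedByIntegerVectors S) :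
    ∃ D : ℝ, ∀ v ∈ S, ∃ z ∈ integerVectors S, ‖whiten P (v + castVector z)‖ ≤ D := by
  have := discreteTopology_whitenedLattice hP S
  have : IsZLattice ℝ (whitenedLattice P S) := ⟨span_whitenedLattice P hS⟩
  obtain ⟨D, hD⟩ := exists_mem_lattice_norm_add_le (whitenedLattice P S)
  refine ⟨D, fun v hv => ?_⟩
  obtain ⟨_, ⟨z, rfl⟩, hz⟩ := hD ⟨whiten P v, v, hv, rfl⟩
  refine ⟨z, z.2, ?_⟩
  rw [map_add]
  exact hz

/-- The component of the scaled deviation that is normal to `S` in the information metric at `P`.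
It only depends on the coset of `N` modulo `S`, and its length is the distance of the coset from
the mean. -/
def normalDeviation (P : 𝒳 → ℝ) (S : Submodule ℝ (𝒳 → ℝ)) (n : ℕ) (N : 𝒳 → ℤ) :
    EuclideanSpace ℝ 𝒳 :=
  (S.map (whiten P))ᗮ.starProjection (scaledDeviation P n N)

theorem norm_normalDeviation_le (P : 𝒳 → ℝ) (S : Submodule ℝ (𝒳 → ℝ)) (n : ℕ) (N : 𝒳 → ℤ) :
    ‖normalDeviation P S n N‖ ≤ ‖scaledDeviation P n N‖ :=
  Submodule.norm_starProjection_apply_le _ _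

theorem exists_norm_sq_scaledDeviation_add_eq (P : 𝒳 → ℝ) (S : Submodule ℝ (𝒳 → ℝ)) {n : ℕ}
    (hn : n ≠ 0) (N : 𝒳 → ℤ) :
    ∃ a : S.map (whiten P), ∀ z : integerVectors S,
      ‖scaledDeviation P n (N + z)‖ ^ 2 =
        ‖normalDeviation P S n N‖ ^ 2 + ‖(√n)⁻¹ • (whitenInt P S z + a)‖ ^ 2 := by
  have hsqrt : √(n : ℝ) ≠ 0 := by positivity
  set T := S.map (whiten P)
  set s : T := T.orthogonalProjectionOnto (scaledDeviation P n N)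
  refine ⟨√n • s, fun z => ?_⟩
  have hdecomp : scaledDeviation P n (N + z) =
      normalDeviation P S n N + ((√n)⁻¹ • (whitenInt P S z + √n • s) : T) := by
    have hproj : scaledDeviation P n N = s + normalDeviation P S n N :=
      (T.starProjection_add_starProjection_orthogonal _).symm
    rw [scaledDeviation_add, smul_add, inv_smul_smul₀ hsqrt, Submodule.coe_add,
      Submodule.coe_smul, coe_whitenInt, hproj]
    abel
  rw [hdecomp, sq, norm_add_sq_eq_norm_sq_add_norm_sq_real, ← sq, ← sq, Submodule.coe_norm]
  exact Submodule.inner_left_of_mem_orthogonal (Subtype.mem _)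
    (Submodule.starProjection_apply_mem _ _)

theorem exists_abs_tsum_exp_neg_mul_norm_sq_scaledDeviation_sub_le {P : 𝒳 → ℝ}
    (hP : P ∈ openSimplex 𝒳) {S : Submodule ℝ (𝒳 → ℝ)} (hS : SpannedByIntegerVectors S) {b : ℝ}
    (hb : 0 < b) :
    ∃ I : ℝ, 0 < I ∧ ∃ C : ℝ, 0 ≤ C ∧ ∀ (n : ℕ) (N : 𝒳 → ℤ), n ≠ 0 →
      Summable (fun z : integerVectors S => Real.exp (-(b * ‖scaledDeviation P n (N + z)‖ ^ 2))) ∧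
      |∑' z : integerVectors S, Real.exp (-(b * ‖scaledDeviation P n (N + z)‖ ^ 2)) -
        √n ^ finrank ℝ S * I * Real.exp (-(b * ‖normalDeviation P S n N‖ ^ 2))| ≤
          √n ^ finrank ℝ S * (C / √n) := by
  have := discreteTopology_whitenedLattice hP S
  have : IsZLattice ℝ (whitenedLattice P S) := ⟨span_whitenedLattice P hS⟩
  obtain ⟨I, hI, C, hC, hlattice⟩ :=
    exists_abs_tsum_exp_neg_mul_norm_sq_sub_le (whitenedLattice P S) hb
  refine ⟨I, hI, C, hC, fun n N hn => ?_⟩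
  have hsqrt : 1 ≤ √(n : ℝ) := Real.one_le_sqrt.2 (by exact_mod_cast Nat.one_le_iff_ne_zero.2 hn)
  have hfinrank : finrank ℝ (S.map (whiten P)) = finrank ℝ S :=
    (Submodule.equivMapOfInjective _ (whiten_injective hP.1) S).finrank_eq.symm
  obtain ⟨a, ha⟩ := exists_norm_sq_scaledDeviation_add_eq P S hn N
  obtain ⟨hsummable, hsum⟩ := hlattice _ hsqrt a
  set e := AddMonoidHom.ofInjective (whitenInt_injective hP.1 S)
  set m := Real.exp (-(b * ‖normalDeviation P S n N‖ ^ 2))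
  have hterm (z : integerVectors S) : Real.exp (-(b * ‖scaledDeviation P n (N + z)‖ ^ 2)) =
      m * Real.exp (-(b * ‖(√n)⁻¹ • ((e z : S.map (whiten P)) + a)‖ ^ 2)) := by
    rw [← Real.exp_add, ha, mul_add, neg_add]
    rfl
  have hm : m ≤ 1 := Real.exp_le_one_iff.2 (by rw [neg_nonpos]; positivity)
  have htsum : ∑' z, Real.exp (-(b * ‖(√n)⁻¹ • ((e z : S.map (whiten P)) + a)‖ ^ 2)) =
      ∑' l : whitenedLattice P S,
        Real.exp (-(b * ‖(√n)⁻¹ • ((l : S.map (whiten P)) + a)‖ ^ 2)) :=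
    e.toEquiv.tsum_eq fun l : whitenedLattice P S =>
      Real.exp (-(b * ‖(√n)⁻¹ • ((l : S.map (whiten P)) + a)‖ ^ 2))
  simp only [hterm]
  refine ⟨((e.toEquiv.summable_iff).2 hsummable).mul_left m, ?_⟩
  rw [tsum_mul_left, htsum, mul_comm _ m, ← mul_sub, abs_mul, abs_of_pos (Real.exp_pos _),
    ← hfinrank, mul_comm (√n ^ _) (C / √n)]
  exact (mul_le_of_le_one_left (abs_nonneg _) hm).trans hsum

end Whitening

section CosetSum

open Module Real

/-! ### Sums of count weights over cosets -/

theorem abs_tsum_sub_tsum_le {ι : Type*} {f g b : ι → ℝ} (hg : Summable g) (hb : Summable b)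
    (hfg : ∀ i, |f i - g i| ≤ b i) :
    Summable f ∧ |∑' i, f i - ∑' i, g i| ≤ ∑' i, b i := by
  have hf : Summable f := by simpa using (Summable.of_norm_bounded hb hfg).add hg
  refine ⟨hf, ?_⟩
  rw [← hf.tsum_sub hg, ← norm_eq_abs]
  exact tsum_of_norm_bounded hb.hasSum hfg

variable {𝒳 : Type*} [Fintype 𝒳] {P : 𝒳 → ℝ} {S : Submodule ℝ (𝒳 → ℝ)}

theorem sum_add_integerVectors (hS₀ : ∀ v ∈ S, ∑ x, v x = 0) (N : 𝒳 → ℤ) (z : integerVectors S) :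
    ∑ x, (N + z.1) x = ∑ x, N x := by
  have hz : ∑ x, z.1 x = 0 := by
    have hcast := hS₀ _ (mem_integerVectors.1 z.2)
    simp only [castVector_apply] at hcast
    exact_mod_cast hcast
  simp only [Pi.add_apply, Finset.sum_add_distrib, hz, add_zero]

theorem exists_tsum_exp_neg_mul_norm_sq_scaledDeviation_le (hP : P ∈ openSimplex 𝒳)
    (hS : SpannedByIntegerVectors S) {b : ℝ} (hb : 0 < b) :
    ∃ C : ℝ, 0 ≤ C ∧ ∀ (n : ℕ) (N : 𝒳 → ℤ), n ≠ 0 →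
      Summable (fun z : integerVectors S => exp (-(b * ‖scaledDeviation P n (N + z)‖ ^ 2))) ∧
      ∑' z : integerVectors S, exp (-(b * ‖scaledDeviation P n (N + z)‖ ^ 2)) ≤
        √n ^ finrank ℝ S * C := by
  obtain ⟨I, hI, C, hC, hgauss⟩ :=
    exists_abs_tsum_exp_neg_mul_norm_sq_scaledDeviation_sub_le hP hS hb
  refine ⟨I + C, by positivity, fun n N hn => ?_⟩
  obtain ⟨hsummable, hsum⟩ := hgauss n N hn
  refine ⟨hsummable, ?_⟩
  have hsqrt : 1 ≤ √(n : ℝ) := one_le_sqrt.2 (by exact_mod_cast Nat.one_le_iff_ne_zero.2 hn)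
  have hm : exp (-(b * ‖normalDeviation P S n N‖ ^ 2)) ≤ 1 :=
    exp_le_one_iff.2 (by rw [neg_nonpos]; positivity)
  calc _ ≤ √n ^ finrank ℝ S * I * exp (-(b * ‖normalDeviation P S n N‖ ^ 2)) +
        √n ^ finrank ℝ S * (C / √n) := by linarith [(abs_le.1 hsum).2]
    _ ≤ √n ^ finrank ℝ S * I * 1 + √n ^ finrank ℝ S * C := by
        gcongr
        exact div_le_self hC hsqrt
    _ = √n ^ finrank ℝ S * (I + C) := by ring

theorem exists_abs_tsum_countWeight_sub_le (hP : P ∈ openSimplex 𝒳)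
    (hS : SpannedByIntegerVectors S) (hS₀ : ∀ v ∈ S, ∑ x, v x = 0) :
    ∃ I : ℝ, 0 < I ∧ ∃ C : ℝ, 0 ≤ C ∧ ∀ (n : ℕ) (N : 𝒳 → ℤ), n ≠ 0 → ∑ x, N x = n →
      |∑' z : integerVectors S, countWeight P n (N + z) -
        √n ^ finrank ℝ S * I * exp (-(‖normalDeviation P S n N‖ ^ 2 / 2))| ≤
          √n ^ finrank ℝ S * (C / √n) := by
  obtain ⟨C₀, hC₀, c, hc, -, hweight⟩ := exists_abs_countWeight_sub_exp_le hP.1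
  obtain ⟨I, hI, C₁, hC₁, hgauss⟩ :=
    exists_abs_tsum_exp_neg_mul_norm_sq_scaledDeviation_sub_le hP hS one_half_pos
  obtain ⟨C₂, hC₂, herror⟩ := exists_tsum_exp_neg_mul_norm_sq_scaledDeviation_le hP hS hc
  simp only [one_div_mul_eq_div] at hgauss
  refine ⟨I, hI, C₀ * C₂ + C₁, by positivity, fun n N hn hN => ?_⟩
  obtain ⟨hgauss_summable, hgauss_sum⟩ := hgauss n N hn
  obtain ⟨herror_summable, herror_sum⟩ := herror n N hn
  obtain ⟨-, hreplace⟩ := abs_tsum_sub_tsum_le hgauss_summable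
    (herror_summable.mul_left (C₀ / √n)) fun z =>
      hweight n (N + z) hn (by rw [sum_add_integerVectors hS₀, hN])
  rw [tsum_mul_left] at hreplace
  calc _ ≤ C₀ / √n * (√n ^ finrank ℝ S * C₂) + √n ^ finrank ℝ S * (C₁ / √n) := by
        refine (abs_sub_le _ _ _).trans (add_le_add (hreplace.trans ?_) hgauss_sum)
        gcongr
    _ = √n ^ finrank ℝ S * ((C₀ * C₂ + C₁) / √n) := by ring

theorem exists_countWeight_le_exp (hP : ∀ x, 0 < P x) :
    ∃ C : ℝ, 0 ≤ C ∧ ∃ c : ℝ, 0 < c ∧ ∀ (n : ℕ) (N : 𝒳 → ℤ), n ≠ 0 → ∑ x, N x = n →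
      countWeight P n N ≤ C * exp (-(c * ‖scaledDeviation P n N‖ ^ 2)) := by
  obtain ⟨C, hC, c, hc, hc_half, hweight⟩ := exists_abs_countWeight_sub_exp_le hP
  refine ⟨C + 1, by positivity, c, hc, fun n N hn hN => ?_⟩
  have hsqrt : 1 ≤ √(n : ℝ) := one_le_sqrt.2 (by exact_mod_cast Nat.one_le_iff_ne_zero.2 hn)
  set t := ‖scaledDeviation P n N‖ ^ 2
  have ht : 0 ≤ t := sq_nonneg _
  calc countWeight P n N ≤ C / √n * exp (-(c * t)) + exp (-(t / 2)) := by
        linarith [(abs_le.1 (hweight n N hn hN)).2]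
    _ ≤ C * exp (-(c * t)) + exp (-(c * t)) := by
        gcongr
        · exact div_le_self hC hsqrt
        · nlinarith
    _ = (C + 1) * exp (-(c * t)) := by ring

theorem exists_tsum_countWeight_tail_le (hP : P ∈ openSimplex 𝒳) (hS : SpannedByIntegerVectors S)
    (hS₀ : ∀ v ∈ S, ∑ x, v x = 0) :
    ∃ C : ℝ, 0 ≤ C ∧ ∃ c : ℝ, 0 < c ∧ ∀ (n : ℕ) (N : 𝒳 → ℤ) (K : ℝ), n ≠ 0 → ∑ x, N x = n →
      ∑' z : integerVectors S,
        {M | K < ‖scaledDeviation P n M‖ ^ 2}.indicator (countWeight P n) (N + z) ≤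
          √n ^ finrank ℝ S * (C * exp (-(c * K))) := by
  obtain ⟨C₀, hC₀, c, hc, hweight⟩ := exists_countWeight_le_exp hP.1
  obtain ⟨C, hC, hgauss⟩ :=
    exists_tsum_exp_neg_mul_norm_sq_scaledDeviation_le hP hS (half_pos hc)
  refine ⟨C₀ * C, by positivity, c / 2, by positivity, fun n N K hn hN => ?_⟩
  obtain ⟨hgauss_summable, hgauss_sum⟩ := hgauss n N hn
  set tail : Set (𝒳 → ℤ) := {M | K < ‖scaledDeviation P n M‖ ^ 2}
  have hterm (z : integerVectors S) : tail.indicator (countWeight P n) (N + z) ≤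
      C₀ * exp (-(c / 2 * K)) * exp (-(c / 2 * ‖scaledDeviation P n (N + z)‖ ^ 2)) := by
    refine Set.indicator_apply_le' (fun hz => ?_) fun _ => by positivity
    refine (hweight n (N + z) hn (by rw [sum_add_integerVectors hS₀, hN])).trans ?_
    rw [mul_assoc, ← exp_add]
    gcongr
    nlinarith [show K < ‖scaledDeviation P n (N + z)‖ ^ 2 from hz]
  have hnonneg (z : integerVectors S) : 0 ≤ tail.indicator (countWeight P n) (N + z) :=
    Set.indicator_nonneg (fun M _ => countWeight_nonneg hP.1 hn M) _
  have hbound_summable := hgauss_summable.mul_left (C₀ * exp (-(c / 2 * K)))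
  calc _ ≤ ∑' z : integerVectors S, C₀ * exp (-(c / 2 * K)) *
          exp (-(c / 2 * ‖scaledDeviation P n (N + z)‖ ^ 2)) :=
        (Summable.of_nonneg_of_le hnonneg hterm hbound_summable).tsum_le_tsum hterm hbound_summable
    _ ≤ C₀ * exp (-(c / 2 * K)) * (√n ^ finrank ℝ S * C) := by
        rw [tsum_mul_left]
        gcongr
    _ = √n ^ finrank ℝ S * (C₀ * C * exp (-(c / 2 * K))) := by ring

end CosetSum

section Counts

open scoped Nat

/-! ### The law of the counts -/

variable {𝒳 Ω : Type*} {q : ℕ}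

theorem momentMap_apply [Fintype 𝒳] (f : 𝒳 → Fin q → ℝ) (v : 𝒳 → ℝ) :
    momentMap f v = ∑ x, v x • f x := by
  ext j
  simp [momentMap, Matrix.mulVec, dotProduct, mul_comm]

variable [DecidableEq 𝒳]

/-- The number of occurrences of every point of `𝒳` among the first `n` observations. -/
def counts (X : ℕ → Ω → 𝒳) (n : ℕ) (ω : Ω) : 𝒳 → ℕ :=
  ∑ i ∈ Finset.range n, Pi.single (X i ω) 1

/-- The counts as integers, so that deviations of counts are vectors of the same kind. -/
def intCounts (X : ℕ → Ω → 𝒳) (n : ℕ) (ω : Ω) : 𝒳 → ℤ := fun x => counts X n ω x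

theorem counts_succ (X : ℕ → Ω → 𝒳) (n : ℕ) (ω : Ω) :
    counts X (n + 1) ω = counts X n ω + Pi.single (X n ω) 1 := Finset.sum_range_succ _ _

theorem empiricalType_eq (X : ℕ → Ω → 𝒳) (n : ℕ) (ω : Ω) :
    empiricalType X n ω = (n : ℝ)⁻¹ • castVector (intCounts X n ω) := by
  ext x
  simp [empiricalType, intCounts, counts, Finset.sum_apply, Pi.single_apply, eq_comm]

theorem sampleMoment_eq [Fintype 𝒳] (X : ℕ → Ω → 𝒳) (f : 𝒳 → Fin q → ℝ) (n : ℕ) (ω : Ω) :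
    sampleMoment X f n ω = (n : ℝ)⁻¹ • momentMap f (castVector (intCounts X n ω)) := by
  have hcast : castVector (intCounts X n ω) =
      ∑ i ∈ Finset.range n, (Pi.single (X i ω) 1 : 𝒳 → ℝ) := by
    ext x
    simp [intCounts, counts, Finset.sum_apply, Pi.single_apply]
  simp only [sampleMoment, hcast, map_sum, momentMap_apply, Pi.single_apply, ite_smul, one_smul,
    zero_smul, Finset.sum_ite_eq', Finset.mem_univ, if_true]

theorem prod_pow_div_factorial_add_single [Fintype 𝒳] (Q : 𝒳 → ℝ) (k : 𝒳 → ℕ) (x : 𝒳) :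
    (k x + 1) * ∏ y, (Q y ^ (k + Pi.single x 1 : 𝒳 → ℕ) y / ((k + Pi.single x 1 : 𝒳 → ℕ) y)!) =
      Q x * ∏ y, (Q y ^ k y / (k y)!) := by
  rw [← Finset.mul_prod_erase _ _ (Finset.mem_univ x),
    ← Finset.mul_prod_erase _ (fun y => Q y ^ k y / ((k y)! : ℝ)) (Finset.mem_univ x),
    Finset.prod_congr rfl fun y hy => by
      rw [Pi.add_apply, Pi.single_eq_of_ne (Finset.ne_of_mem_erase hy), add_zero]]
  simp only [Pi.add_apply, Pi.single_eq_same, Nat.factorial_succ]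
  push_cast
  field_simp
  ring

variable [MeasurableSpace 𝒳] [MeasurableSpace Ω]

/-- The `X i` are independent observations from `Q`. -/
structure IsIIDSample (μ : Measure Ω) (Q : 𝒳 → ℝ) (X : ℕ → Ω → 𝒳) : Prop where
  measurable : ∀ i, Measurable (X i)
  indep : iIndepFun X μ
  law : ∀ i x, μ.real {ω | X i ω = x} = Q x

variable [MeasurableSingletonClass 𝒳] {μ : Measure Ω} {Q : 𝒳 → ℝ} {X : ℕ → Ω → 𝒳}

theorem measurable_counts [Finite 𝒳] (hX : ∀ i, Measurable (X i)) (n : ℕ) :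
    Measurable (counts X n) :=
  Finset.measurable_fun_sum _ fun i _ =>
    (measurable_of_finite fun x : 𝒳 => (Pi.single x 1 : 𝒳 → ℕ)).comp (hX i)

theorem measurable_intCounts [Finite 𝒳] (hX : ∀ i, Measurable (X i)) (n : ℕ) :
    Measurable (intCounts X n) :=
  (measurable_of_countable fun k : 𝒳 → ℕ => fun x => (k x : ℤ)).comp (measurable_counts hX n)

theorem measureReal_counts_inter [Finite 𝒳] (hX : IsIIDSample μ Q X) (n : ℕ) (k : 𝒳 → ℕ) (x : 𝒳) :
    μ.real ({ω | counts X n ω = k} ∩ {ω | X n ω = x}) =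
      μ.real {ω | counts X n ω = k} * Q x := by
  have hsingle : Measurable fun x : 𝒳 => (Pi.single x 1 : 𝒳 → ℕ) := measurable_of_finite _
  have hindep := (hX.indep.comp (fun _ x => (Pi.single x 1 : 𝒳 → ℕ)) fun _ => hsingle)
    |>.indepFun_finsetSum_of_notMem (fun i => hsingle.comp (hX.measurable i))
      (Finset.notMem_range_self (n := n))
  have hcounts : (∑ i ∈ Finset.range n, (fun x => (Pi.single x 1 : 𝒳 → ℕ)) ∘ X i) = counts X n := by
    ext ω : 1
    simp [counts, Finset.sum_apply]
  have hlast : {ω | X n ω = x} =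
      (fun x => (Pi.single x 1 : 𝒳 → ℕ)) ∘ X n ⁻¹' {Pi.single x 1} := by
    ext ω
    refine ⟨fun hω => congrArg (fun x => Pi.single x 1) hω, fun hω => ?_⟩
    simpa [Pi.single_apply, eq_comm] using congrFun hω x
  rw [hcounts] at hindep
  rw [← hX.law n x, hlast]
  exact (congrArg ENNReal.toReal (hindep.measure_inter_preimage_eq_mul {k} _
    (measurableSet_singleton k) (measurableSet_singleton _))).trans ENNReal.toReal_mul

variable [Fintype 𝒳]

theorem measureReal_counts_succ_inter (hX : IsIIDSample μ Q X) {n : ℕ} {k : 𝒳 → ℕ}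
    (hn : ∀ k : 𝒳 → ℕ, ∑ x, k x = n →
      μ.real {ω | counts X n ω = k} = n ! * ∏ x, (Q x ^ k x / (k x)!))
    (hk : ∑ x, k x = n + 1) (x : 𝒳) :
    μ.real ({ω | counts X (n + 1) ω = k} ∩ {ω | X n ω = x}) =
      k x * (n ! * ∏ y, (Q y ^ k y / (k y)!)) := by
  have hstep : {ω | counts X (n + 1) ω = k} ∩ {ω | X n ω = x} =
      {ω | counts X n ω + Pi.single x 1 = k} ∩ {ω | X n ω = x} := by
    ext ω
    simp only [counts_succ, Set.mem_inter_iff, Set.mem_ofPred_eq, and_congr_left_iff]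
    rintro rfl
    rfl
  rw [hstep]
  rcases Nat.eq_zero_or_pos (k x) with hx | hx
  · have hempty : {ω | counts X n ω + Pi.single x 1 = k} = ∅ :=
      Set.eq_empty_of_forall_notMem fun ω hω => by simpa [hx] using congrFun hω x
    rw [hempty, Set.empty_inter, measureReal_empty, hx, Nat.cast_zero, zero_mul]
  · have hle : Pi.single x 1 ≤ k := fun y => by
      rcases eq_or_ne y x with rfl | hy
      · rwa [Pi.single_eq_same]
      · simp [hy]
    obtain ⟨k, rfl⟩ := le_iff_exists_add'.1 hle
    have hk' : ∑ y, k y = n := by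
      simpa [Finset.sum_add_distrib] using hk
    simp only [add_left_inj]
    rw [measureReal_counts_inter hX, hn k hk', mul_assoc, mul_comm _ (Q x),
      ← prod_pow_div_factorial_add_single]
    simp only [Pi.add_apply, Pi.single_eq_same]
    push_cast
    ring

theorem measureReal_counts_eq (hX : IsIIDSample μ Q X) {n : ℕ} {k : 𝒳 → ℕ} (hk : ∑ x, k x = n) :
    μ.real {ω | counts X n ω = k} = n ! * ∏ x, (Q x ^ k x / (k x)!) := by
  have := hX.indep.isProbabilityMeasure
  induction n generalizing k with
  | zero =>
    obtain rfl : k = 0 := funext fun x => Finset.sum_eq_zero_iff.1 hk x (Finset.mem_univ x)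
    simp [counts]
  | succ n ih =>
    have hsplit := sum_measureReal_preimage_singleton
      (μ := μ.restrict {ω | counts X (n + 1) ω = k}) (f := X n) Finset.univ
      fun x _ => hX.measurable n (measurableSet_singleton x)
    have hmeas : MeasurableSet {ω | counts X (n + 1) ω = k} :=
      measurable_counts hX.measurable (n + 1) (measurableSet_singleton k)
    rw [Finset.coe_univ, Set.preimage_univ, measureReal_restrict_apply_univ] at hsplit
    rw [← hsplit]
    calc _ = ∑ x, k x * (n ! * ∏ y, (Q y ^ k y / (k y)!)) :=
          Finset.sum_congr rfl fun x _ => by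
            rw [measureReal_restrict_apply' hmeas, Set.inter_comm]
            exact measureReal_counts_succ_inter hX (fun k hk => ih hk) hk x
      _ = (n + 1)! * ∏ x, (Q x ^ k x / (k x)!) := by
          have hk' : ∑ x, (k x : ℝ) = n + 1 := by exact_mod_cast hk
          rw [← Finset.sum_mul, hk', Nat.factorial_succ]
          push_cast
          ring

end Counts

section Tilt

open Real
open scoped Nat

/-! ### The information projection -/

theorem measureReal_eq_tsum_indicator {α : Type*} [Countable α] [MeasurableSpace α]
    [MeasurableSingletonClass α] (μ : Measure α) [IsFiniteMeasure μ] (s : Set α) :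
    μ.real s = ∑' x, s.indicator (fun x => μ.real {x}) x := by
  rw [measureReal_def, ← Measure.tsum_indicator_apply_singleton μ s s.to_countable.measurableSet,
    ENNReal.tsum_toReal_eq fun x => ne_top_of_le_ne_top (measure_ne_top μ {x})
      (Set.indicator_le_self s (fun x => μ {x}) x)]
  exact tsum_congr fun x => (s.indicator_comp_of_zero (g := ENNReal.toReal) rfl ▸ rfl)

variable {𝒳 : Type*}

/-- The integer vectors in the affine subspace `n P + T`, which contains the counts of the samples
of size `n` whose empirical type lies in `P + T`. -/
def integerPoints (P : 𝒳 → ℝ) (T : Submodule ℝ (𝒳 → ℝ)) (n : ℕ) : Set (𝒳 → ℤ) :=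
  {N | castVector N - (n : ℝ) • P ∈ T}

theorem add_mem_integerPoints {P : 𝒳 → ℝ} {T : Submodule ℝ (𝒳 → ℝ)} {n : ℕ} {N z : 𝒳 → ℤ}
    (hN : N ∈ integerPoints P T n) (hz : z ∈ integerVectors T) :
    N + z ∈ integerPoints P T n := by
  simpa only [integerPoints, Set.mem_ofPred_eq, map_add, sub_add_eq_add_sub] using
    T.add_mem hN (mem_integerVectors.1 hz)

variable [Fintype 𝒳] {d : ℕ} {h : 𝒳 → Fin d → ℝ} {a : Fin d → ℝ} {P Q v : 𝒳 → ℝ} {n : ℕ}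

theorem sum_eq_of_mem_integerPoints {N : 𝒳 → ℤ} (hP : P ∈ openSimplex 𝒳)
    (hN : N ∈ integerPoints P (tangentSpace h) n) : ∑ x, N x = n := by
  have hsum := hN.1
  simp only [Pi.sub_apply, Pi.smul_apply, castVector_apply, smul_eq_mul, Finset.sum_sub_distrib,
    ← Finset.mul_sum, hP.2, mul_one, sub_eq_zero] at hsum
  exact_mod_cast hsum

theorem add_mem_constraintSet (hP : P ∈ constraintSet h a) (hv : v ∈ tangentSpace h)
    (hpos : ∀ x, 0 < P x + v x) : P + v ∈ constraintSet h a := by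
  refine ⟨⟨hpos, ?_⟩, ?_⟩
  · simp only [Pi.add_apply, Finset.sum_add_distrib, hP.1.2, hv.1, add_zero]
  · rw [map_add, hP.2, hv.2, add_zero]

theorem sub_mem_tangentSpace {R : 𝒳 → ℝ} (hP : P ∈ constraintSet h a)
    (hR : R ∈ constraintSet h a) : R - P ∈ tangentSpace h := by
  refine ⟨?_, ?_⟩
  · simp only [Pi.sub_apply, Finset.sum_sub_distrib, hP.1.2, hR.1.2, sub_self]
  · rw [map_sub, hP.2, hR.2, sub_self]

theorem hasDerivAt_klDivergence (hP : ∀ x, P x ≠ 0) (hQ : ∀ x, Q x ≠ 0) (v : 𝒳 → ℝ) :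
    HasDerivAt (fun t : ℝ => klDivergence (P + t • v) Q)
      (∑ x, (v x * log (P x / Q x) + v x)) 0 := by
  refine HasDerivAt.fun_sum fun x _ => ?_
  have hline : HasDerivAt (fun t : ℝ => (P + t • v) x) (v x) 0 := by
    simpa using ((hasDerivAt_id (0 : ℝ)).mul_const (v x)).const_add (P x)
  have hlog := (hline.div_const (Q x)).log (by simpa using div_ne_zero (hP x) (hQ x))
  have hcancel : v x / Q x / (P x / Q x) * P x = v x := by
    have := hP x
    have := hQ x
    field_simp
  simpa [mul_comm (P x), hcancel] using hline.fun_mul hlog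

theorem sum_mul_log_eq_zero (hQ : ∀ x, 0 < Q x)
    (hP : IsInformationProjection Q (constraintSet h a) P) (hv : v ∈ tangentSpace h) :
    ∑ x, v x * log (P x / Q x) = 0 := by
  have hpos := hP.1.1.1
  have hnear : ∀ᶠ t : ℝ in nhds 0, ∀ x, 0 < P x + t * v x := by
    refine Filter.eventually_all.2 fun x => ?_
    have hcont : ContinuousAt (fun t : ℝ => P x + t * v x) 0 := by fun_prop
    exact hcont.eventually (lt_mem_nhds (by simpa using hpos x))
  have hmin : IsLocalMin (fun t : ℝ => klDivergence (P + t • v) Q) 0 := by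
    filter_upwards [hnear] with t ht
    simpa only [zero_smul, add_zero] using
      hP.2 _ (add_mem_constraintSet hP.1 (Submodule.smul_mem _ t hv) ht)
  have hderiv := hmin.hasDerivAt_eq_zero
    (hasDerivAt_klDivergence (fun x => (hpos x).ne') (fun x => (hQ x).ne') v)
  rwa [Finset.sum_add_distrib, hv.1, add_zero] at hderiv

theorem sum_mul_log_eq_mul_klDivergence {N : 𝒳 → ℤ} (hQ : ∀ x, 0 < Q x)
    (hP : IsInformationProjection Q (constraintSet h a) P)
    (hN : N ∈ integerPoints P (tangentSpace h) n) :
    ∑ x, N x * log (P x / Q x) = n * klDivergence P Q := by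
  have horth := sum_mul_log_eq_zero hQ hP hN
  simp only [Pi.sub_apply, Pi.smul_apply, castVector_apply, smul_eq_mul, sub_mul, mul_assoc,
    Finset.sum_sub_distrib, ← Finset.mul_sum, sub_eq_zero] at horth
  exact horth

theorem prod_pow_eq_exp_mul_prod_pow (hP : ∀ x, 0 < P x) (hQ : ∀ x, 0 < Q x) (k : 𝒳 → ℕ) :
    ∏ x, Q x ^ k x = exp (-∑ x, k x * log (P x / Q x)) * ∏ x, P x ^ k x := by
  rw [← Finset.sum_neg_distrib, exp_sum, ← Finset.prod_mul_distrib]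
  refine Finset.prod_congr rfl fun x _ => ?_
  have hPx := hP x
  have hQx := hQ x
  rw [← mul_neg, ← log_inv, inv_div, exp_nat_mul, exp_log (by positivity), ← mul_pow,
    div_mul_cancel₀ _ hPx.ne']

theorem prod_poissonTerm_eq (P : 𝒳 → ℝ) {k : 𝒳 → ℕ} (hk : ∑ x, k x = n) :
    ∏ x, poissonTerm (n * P x) (k x) =
      (∏ x, √(2 * π * (n * P x)) * exp (-(n * P x))) * n ^ n * ∏ x, (P x ^ k x / (k x)!) := by
  have hpow : (n : ℝ) ^ n = ∏ x, (n : ℝ) ^ k x := by rw [Finset.prod_pow_eq_pow_sum, hk]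
  rw [hpow, ← Finset.prod_mul_distrib, ← Finset.prod_mul_distrib]
  refine Finset.prod_congr rfl fun x _ => ?_
  rw [poissonTerm, mul_pow]
  ring

variable [DecidableEq 𝒳] {Ω : Type*}

theorem empiricalType_mem_constraintSet_iff (hP : P ∈ constraintSet h a) (X : ℕ → Ω → 𝒳)
    (hn : n ≠ 0) (ω : Ω) :
    empiricalType X n ω ∈ constraintSet h a ↔
      (∀ x, 0 < intCounts X n ω x) ∧ intCounts X n ω ∈ integerPoints P (tangentSpace h) n := by
  have hn' : (0 : ℝ) < n := by positivity
  have hpos (x : 𝒳) : 0 < empiricalType X n ω x ↔ 0 < intCounts X n ω x := by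
    simp [empiricalType_eq, hn']
  have hdev : castVector (intCounts X n ω) - (n : ℝ) • P =
      (n : ℝ) • (empiricalType X n ω - P) := by
    rw [empiricalType_eq, smul_sub, smul_inv_smul₀ hn'.ne']
  rw [integerPoints, Set.mem_ofPred_eq, hdev, Submodule.smul_mem_iff _ hn'.ne']
  constructor
  · exact fun hmem => ⟨fun x => (hpos x).1 (hmem.1.1 x), sub_mem_tangentSpace hP hmem⟩
  · rintro ⟨hcounts, hmem⟩
    have hadd := add_mem_constraintSet hP hmem fun x => by
      rw [Pi.sub_apply, add_sub_cancel]
      exact (hpos x).2 (hcounts x)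
    rwa [add_sub_cancel] at hadd

variable [MeasurableSpace 𝒳] [MeasurableSingletonClass 𝒳] [MeasurableSpace Ω] {μ : Measure Ω}
  {X : ℕ → Ω → 𝒳}

theorem exists_measureReal_intCounts_eq (hX : IsIIDSample μ Q X) (hQ : ∀ x, 0 < Q x)
    (hP : IsInformationProjection Q (constraintSet h a) P) (hn : n ≠ 0) :
    ∃ K : ℝ, 0 < K ∧ ∀ N ∈ integerPoints P (tangentSpace h) n, (∀ x, 0 < N x) →
      μ.real {ω | intCounts X n ω = N} = K * countWeight P n N := by
  have hpos := hP.1.1.1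
  set c := ∏ x, √(2 * π * (n * P x)) * exp (-(n * P x)) with hc
  have hc_pos : 0 < c := Finset.prod_pos fun x _ => by
    have := hpos x
    positivity
  refine ⟨n ! * exp (-(n * klDivergence P Q)) / (c * n ^ n), by positivity, fun N hN hN_pos => ?_⟩
  have hlog := sum_mul_log_eq_mul_klDivergence hQ hP hN
  have hsum := sum_eq_of_mem_integerPoints hP.1.1 hN
  lift N to 𝒳 → ℕ using fun x => (hN_pos x).le with k
  have hk : ∑ x, k x = n := by exact_mod_cast hsum
  have hevent : {ω | intCounts X n ω = fun x => (k x : ℤ)} = {ω | counts X n ω = k} := by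
    ext ω
    simp [intCounts, funext_iff]
  simp only [Int.cast_natCast] at hlog
  rw [hevent, measureReal_counts_eq hX hk, countWeight, if_pos hN_pos]
  simp only [Int.toNat_natCast]
  rw [prod_poissonTerm_eq P hk, ← hc, Finset.prod_div_distrib, Finset.prod_div_distrib,
    prod_pow_eq_exp_mul_prod_pow hpos hQ k, hlog]
  field_simp

theorem exists_measureReal_constraint_inter_eq (hX : IsIIDSample μ Q X) (hQ : ∀ x, 0 < Q x)
    (hP : IsInformationProjection Q (constraintSet h a) P) (hn : n ≠ 0) :
    ∃ K : ℝ, 0 < K ∧ ∀ Z ⊆ integerPoints P (tangentSpace h) n,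
      μ.real {ω | empiricalType X n ω ∈ constraintSet h a ∧ intCounts X n ω ∈ Z} =
        K * ∑' N, Z.indicator (countWeight P n) N := by
  have := hX.indep.isProbabilityMeasure
  obtain ⟨K, hK, hcounts⟩ := exists_measureReal_intCounts_eq hX hQ hP hn
  refine ⟨K, hK, fun Z hZ => ?_⟩
  have hmeas := measurable_intCounts hX.measurable n
  have hevent : {ω | empiricalType X n ω ∈ constraintSet h a ∧ intCounts X n ω ∈ Z} =
      intCounts X n ⁻¹' (Z ∩ {N | ∀ x, 0 < N x}) := by
    ext ω
    have := @hZ (intCounts X n ω)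
    simp only [empiricalType_mem_constraintSet_iff hP.1 X hn, Set.mem_ofPred_eq, Set.mem_preimage,
      Set.mem_inter_iff]
    tauto
  have hlaw (N : 𝒳 → ℤ) : (μ.map (intCounts X n)).real {N} = μ.real {ω | intCounts X n ω = N} :=
    map_measureReal_apply hmeas (measurableSet_singleton N)
  rw [hevent, ← map_measureReal_apply hmeas (Set.to_countable _).measurableSet,
    measureReal_eq_tsum_indicator, ← tsum_mul_left]
  refine tsum_congr fun N => ?_
  by_cases hN : N ∈ Z
  · by_cases hN_pos : ∀ x, 0 < N x
    · have hmem : N ∈ Z ∩ {N | ∀ x, 0 < N x} := ⟨hN, hN_pos⟩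
      rw [Set.indicator_of_mem hmem, Set.indicator_of_mem hN, hlaw, hcounts N (hZ hN) hN_pos]
    · rw [Set.indicator_of_notMem fun hmem => hN_pos hmem.2, Set.indicator_of_mem hN, countWeight,
        if_neg hN_pos, mul_zero]
  · rw [Set.indicator_of_notMem fun hmem => hN hmem.1, Set.indicator_of_notMem hN, mul_zero]

theorem exists_measureReal_coset_eq (hX : IsIIDSample μ Q X) (hQ : ∀ x, 0 < Q x)
    (hP : IsInformationProjection Q (constraintSet h a) P) (hn : n ≠ 0) :
    ∃ K : ℝ, 0 < K ∧ ∀ S ≤ tangentSpace h, ∀ N ∈ integerPoints P (tangentSpace h) n,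
      ∀ B : Set (𝒳 → ℤ),
        μ.real {ω | empiricalType X n ω ∈ constraintSet h a ∧
          intCounts X n ω - N ∈ integerVectors S ∧ intCounts X n ω ∈ B} =
        K * ∑' z : integerVectors S, B.indicator (countWeight P n) (N + z) := by
  obtain ⟨K, hK, hevent⟩ := exists_measureReal_constraint_inter_eq hX hQ hP hn
  refine ⟨K, hK, fun S hS N hN B => ?_⟩
  set Z : Set (𝒳 → ℤ) := {M | M - N ∈ integerVectors S}
  have hZ : Z = Set.range fun z : integerVectors S => N + z := by
    ext M
    exact ⟨fun hM => ⟨⟨_, hM⟩, add_sub_cancel _ _⟩, by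
      rintro ⟨z, rfl⟩
      simp [Z]⟩
  have hinj : Function.Injective fun z : integerVectors S => N + z.1 :=
    fun _ _ hzy => Subtype.ext (add_left_cancel hzy)
  have hsubset : Z ⊆ integerPoints P (tangentSpace h) n := by
    rw [hZ]
    rintro _ ⟨z, rfl⟩
    exact add_mem_integerPoints hN (hS z.2)
  calc _ = K * ∑' M, (Z ∩ B).indicator (countWeight P n) M :=
        hevent (Z ∩ B) (Set.inter_subset_left.trans hsubset)
    _ = K * ∑' M : Z, B.indicator (countWeight P n) M := by
        rw [tsum_subtype, Set.indicator_indicator]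
    _ = K * ∑' z : integerVectors S, B.indicator (countWeight P n) (N + z) := by
        rw [hZ, tsum_range _ hinj]

end Tilt

section QuotientMetric

/-! ### The metric induced on moment space -/

theorem isLeast_dotProduct_mulVec_of_mulVec_eq {m k : Type*} [Fintype m] [Fintype k]
    [DecidableEq m] [DecidableEq k] {H : Matrix k k ℝ} (hH : H.PosDef) {M : Matrix m k ℝ}
    (hM : IsUnit (M * H⁻¹ * Mᵀ).det) (u : m → ℝ) :
    IsLeast {e : ℝ | ∃ c, M *ᵥ c = u ∧ e = c ⬝ᵥ (H *ᵥ c)}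
      (u ⬝ᵥ ((M * H⁻¹ * Mᵀ)⁻¹ *ᵥ u)) := by
  set y := (M * H⁻¹ * Mᵀ)⁻¹ *ᵥ u with hy
  set c := H⁻¹ *ᵥ (Mᵀ *ᵥ y) with hc
  have hHc : H *ᵥ c = Mᵀ *ᵥ y := by
    rw [hc, mulVec_mulVec, mul_nonsing_inv _ ((isUnit_iff_isUnit_det _).1 hH.isUnit), one_mulVec]
  have hMc : M *ᵥ c = u := by
    rw [hc, mulVec_mulVec, mulVec_mulVec, hy, mulVec_mulVec, mul_nonsing_inv _ hM, one_mulVec]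
  have hpair (b : k → ℝ) : b ⬝ᵥ (H *ᵥ c) = (M *ᵥ b) ⬝ᵥ y := by
    rw [hHc, dotProduct_mulVec, vecMul_transpose]
  have hsymm (b : k → ℝ) : c ⬝ᵥ (H *ᵥ b) = b ⬝ᵥ (H *ᵥ c) := by
    have hHT : Hᵀ = H := by simpa using hH.isHermitian.eq
    rw [dotProduct_mulVec, ← mulVec_transpose, hHT, dotProduct_comm]
  refine ⟨⟨c, hMc, by rw [hpair, hMc]⟩, ?_⟩
  rintro _ ⟨b, hb, rfl⟩
  have hnonneg : 0 ≤ (b - c) ⬝ᵥ (H *ᵥ (b - c)) := by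
    simpa using hH.posSemidef.dotProduct_mulVec_nonneg (b - c)
  rw [mulVec_sub, sub_dotProduct, dotProduct_sub, dotProduct_sub, hsymm, hpair, hpair, hb, hMc]
    at hnonneg
  linarith

variable {𝒳 : Type*} [Fintype 𝒳] {q r : ℕ} {V : Matrix 𝒳 (Fin r) ℝ} {T : Submodule ℝ (𝒳 → ℝ)}
  {P : 𝒳 → ℝ} {f : 𝒳 → Fin q → ℝ}

theorem restrictedMoment_mulVec (f : 𝒳 → Fin q → ℝ) (V : Matrix 𝒳 (Fin r) ℝ) (c : Fin r → ℝ) :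
    restrictedMoment f V *ᵥ c = momentMap f (V *ᵥ c) :=
  (mulVec_mulVec c _ V).symm

theorem IsOrthonormalBasisOf.mulVec_injective (hV : IsOrthonormalBasisOf V T) :
    Function.Injective V.mulVec := by
  intro c e hce
  simpa only [mulVec_mulVec, hV.1, one_mulVec] using congrArg (Vᵀ *ᵥ ·) hce

theorem IsOrthonormalBasisOf.mem_iff (hV : IsOrthonormalBasisOf V T) {v : 𝒳 → ℝ} :
    v ∈ T ↔ ∃ c, V *ᵥ c = v := by
  rw [← hV.2]
  rfl

variable [DecidableEq 𝒳]

theorem dotProduct_projectedHessian_mulVec (V : Matrix 𝒳 (Fin r) ℝ) (P : 𝒳 → ℝ) (c : Fin r → ℝ) :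
    c ⬝ᵥ (projectedHessian V P *ᵥ c) = ∑ x, (V *ᵥ c) x ^ 2 / P x := by
  rw [projectedHessian, ← mulVec_mulVec, ← mulVec_mulVec, dotProduct_mulVec, vecMul_transpose]
  simp only [dotProduct, mulVec_diagonal]
  exact Finset.sum_congr rfl fun x _ => by ring

theorem posDef_projectedHessian (hV : IsOrthonormalBasisOf V T) (hP : ∀ x, 0 < P x) :
    (projectedHessian V P).PosDef := by
  have hdiag : (diagonal fun x => 1 / P x).PosDef := PosDef.diagonal fun x => one_div_pos.2 (hP x)
  simpa only [projectedHessian, conjTranspose_eq_transpose_of_trivial] using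
    hdiag.conjTranspose_mul_mul_same hV.mulVec_injective

theorem posDef_pushforwardMetric (hV : IsOrthonormalBasisOf V T) (hP : ∀ x, 0 < P x)
    (hf : T.map (momentMap f) = ⊤) : (pushforwardMetric f V P).PosDef := by
  have hinj : Function.Injective (restrictedMoment f V).vecMul := by
    intro y w hyw
    refine dotProduct_eq _ _ fun u => ?_
    obtain ⟨v, hv, rfl⟩ : u ∈ T.map (momentMap f) := hf ▸ Submodule.mem_top
    obtain ⟨c, rfl⟩ := hV.mem_iff.1 hv
    rw [← restrictedMoment_mulVec, dotProduct_mulVec, dotProduct_mulVec]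
    exact congrArg (· ⬝ᵥ c) hyw
  simpa only [pushforwardMetric, conjTranspose_eq_transpose_of_trivial] using
    (posDef_projectedHessian hV hP).inv.mul_mul_conjTranspose_same hinj

theorem isLeast_optimalWeight (hV : IsOrthonormalBasisOf V T) (hP : ∀ x, 0 < P x)
    (hf : T.map (momentMap f) = ⊤) (u : Fin q → ℝ) :
    IsLeast {e : ℝ | ∃ v ∈ T, momentMap f v = u ∧ e = ∑ x, v x ^ 2 / P x}
      (u ⬝ᵥ (optimalWeight f V P *ᵥ u)) := by
  have hunit : IsUnit (pushforwardMetric f V P).det :=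
    (isUnit_iff_isUnit_det _).1 (posDef_pushforwardMetric hV hP hf).isUnit
  convert isLeast_dotProduct_mulVec_of_mulVec_eq (posDef_projectedHessian hV hP) hunit u using 1
  · ext e
    simp [hV.mem_iff, restrictedMoment_mulVec, dotProduct_projectedHessian_mulVec]
  · rfl

end QuotientMetric

section ConditionalLikelihood

open Filter Module Real

/-! ### The conditional likelihood -/

theorem abs_log_sub_log_le {a x : ℝ} (ha : 0 < a) (hx : |x - a| ≤ a / 2) :
    |log x - log a| ≤ 2 / a * |x - a| := by
  have hx_pos : 0 < x := by linarith [(abs_le.1 hx).1]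
  have hratio : 1 + (x - a) / a = x / a := by
    field_simp
    ring
  have hrel : |(x - a) / a| ≤ 1 / 2 := by
    rw [abs_div, abs_of_pos ha, div_le_iff₀ ha]
    linarith
  have hlog := abs_log_one_add_le hrel
  rw [hratio, log_div hx_pos.ne' ha.ne', abs_div, abs_of_pos ha] at hlog
  exact hlog.trans_eq (by ring)

theorem exists_eventually_abs_neg_log_div_sub_le {I C : ℝ} (hI : 0 < I) (B : ℝ) :
    ∃ C' : ℝ, ∀ᶠ t : ℝ in atTop, ∀ x y b : ℝ, b ≤ B → |x - I * exp (-(b / 2))| ≤ C / t →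
      |y - I| ≤ C / t → |-log (x / y) - b / 2| ≤ C' / t := by
  set δ := min I (I * exp (-(B / 2)))
  have hδ : 0 < δ := lt_min hI (by positivity)
  have hsmall : ∀ᶠ t in atTop, C / t ≤ δ / 2 :=
    (tendsto_id.const_div_atTop C).eventually_le_const (half_pos hδ)
  refine ⟨2 / δ * C + 2 / δ * C, ?_⟩
  filter_upwards [hsmall, eventually_gt_atTop 0] with t hδt _ x y b hb hx hy
  set p := I * exp (-(b / 2)) with hp
  have hδp : δ ≤ p := (min_le_right _ _).trans (by rw [hp]; gcongr)
  have hδI : δ ≤ I := min_le_left _ _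
  have hlog {z c : ℝ} (hc : δ ≤ c) (hz : |z - c| ≤ C / t) :
      0 < z ∧ |log z - log c| ≤ 2 / δ * (C / t) := by
    refine ⟨by linarith [(abs_le.1 hz).1], ?_⟩
    refine (abs_log_sub_log_le (hδ.trans_le hc) (by linarith)).trans ?_
    gcongr
  obtain ⟨hx_pos, hlogx⟩ := hlog hδp hx
  obtain ⟨hy_pos, hlogy⟩ := hlog hδI hy
  have hlogp : log p = log I - b / 2 := by
    rw [hp, log_mul hI.ne' (exp_pos _).ne', log_exp, sub_eq_add_neg]
  calc |-log (x / y) - b / 2| = |(log y - log I) - (log x - log p)| := by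
        rw [log_div hx_pos.ne' hy_pos.ne', hlogp]
        ring_nf
    _ ≤ |log y - log I| + |log x - log p| := abs_sub _ _
    _ ≤ 2 / δ * (C / t) + 2 / δ * (C / t) := add_le_add hlogy hlogx
    _ = (2 / δ * C + 2 / δ * C) / t := by ring

theorem one_sub_sq_div_le_exp_neg {D t x : ℝ} (ht : 1 ≤ t) (hx₀ : 0 ≤ x) (hx : x ≤ D / t) :
    1 - D ^ 2 / t ≤ exp (-(x ^ 2 / 2)) := by
  have hsq : x ^ 2 ≤ D ^ 2 / t := by
    calc x ^ 2 ≤ (D / t) ^ 2 := by gcongr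
      _ = D ^ 2 / t ^ 2 := div_pow D t 2
      _ ≤ D ^ 2 / t := by
          gcongr
          exact le_self_pow₀ ht two_ne_zero
  linarith [add_one_le_exp (-(x ^ 2 / 2)), sq_nonneg x]

theorem abs_ciSup_sub_le {ι : Type*} {f : ι → ℝ} {M δ : ℝ} (hle : ∀ i, f i ≤ M + δ) {i : ι}
    (hge : M - δ ≤ f i) : |(⨆ i, f i) - M| ≤ δ := by
  have : Nonempty ι := ⟨i⟩
  have hlower := le_ciSup ⟨M + δ, Set.forall_mem_range.2 hle⟩ i
  have hupper := ciSup_le hle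
  exact abs_le.2 ⟨by linarith, by linarith⟩

section Deviation

variable {𝒳 : Type*} [Fintype 𝒳] {q n : ℕ} {P : 𝒳 → ℝ} {T S : Submodule ℝ (𝒳 → ℝ)}
  {f : 𝒳 → Fin q → ℝ} {N : 𝒳 → ℤ}

theorem normalDeviation_eq_zero (hN : N ∈ integerPoints P S n) : normalDeviation P S n N = 0 := by
  rw [normalDeviation, scaledDeviation_eq, Submodule.starProjection_apply_eq_zero_iff,
    Submodule.orthogonal_orthogonal]
  exact Submodule.smul_mem _ _ ⟨_, hN, rfl⟩

theorem exists_whiten_eq_normalDeviation (P : 𝒳 → ℝ) (S : Submodule ℝ (𝒳 → ℝ)) (n : ℕ)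
    (N : 𝒳 → ℤ) :
    ∃ w ∈ S, whiten P ((√n)⁻¹ • (castVector N - (n : ℝ) • P) - w) = normalDeviation P S n N := by
  obtain ⟨w, hw, hproj⟩ :=
    (S.map (whiten P)).starProjection_apply_mem (scaledDeviation P n N)
  refine ⟨w, hw, ?_⟩
  rw [map_sub, hproj, map_smul, ← scaledDeviation_eq, normalDeviation,
    Submodule.starProjection_orthogonal_val]

theorem isLeast_norm_sq_normalDeviation (hP : ∀ x, 0 ≤ P x) (hf : momentMap f P = 0)
    (hN : N ∈ integerPoints P T n) :
    IsLeast {e : ℝ | ∃ v ∈ T, momentMap f v = (√n)⁻¹ • momentMap f (castVector N) ∧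
      e = ∑ x, v x ^ 2 / P x}
      (‖normalDeviation P (T ⊓ LinearMap.ker (momentMap f)) n N‖ ^ 2) := by
  set S := T ⊓ LinearMap.ker (momentMap f)
  obtain ⟨w, ⟨hwT, hwker⟩, hw⟩ := exists_whiten_eq_normalDeviation P S n N
  set v := (√n)⁻¹ • (castVector N - (n : ℝ) • P) - w with hv
  have hvT : v ∈ T := T.sub_mem (T.smul_mem _ hN) hwT
  have hvf : momentMap f v = (√n)⁻¹ • momentMap f (castVector N) := by
    rw [hv, map_sub, LinearMap.mem_ker.1 hwker, sub_zero, map_smul, map_sub, map_smul, hf,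
      smul_zero, sub_zero]
  refine ⟨⟨v, hvT, hvf, by rw [← hw, norm_sq_whiten hP]⟩, ?_⟩
  rintro _ ⟨y, hyT, hyf, rfl⟩
  have hker : y - v ∈ S := ⟨T.sub_mem hyT hvT, by
    rw [SetLike.mem_coe, LinearMap.mem_ker, map_sub, hyf, hvf, sub_self]⟩
  have horth : inner ℝ (whiten P v) (whiten P (y - v)) = 0 := by
    rw [hw]
    exact Submodule.inner_left_of_mem_orthogonal (Submodule.mem_map_of_mem hker)
      (Submodule.starProjection_apply_mem _ _)
  have hsplit : whiten P y = whiten P v + whiten P (y - v) := by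
    rw [← map_add, add_sub_cancel]
  rw [← norm_sq_whiten hP, ← hw, hsplit, sq, sq, norm_add_sq_eq_norm_sq_add_norm_sq_real horth]
  exact le_add_of_nonneg_right (mul_self_nonneg _)

theorem exists_mem_integerPoints_norm_scaledDeviation_le (hP : P ∈ openSimplex 𝒳)
    (hT : SpannedByIntegerVectors T) :
    ∃ D : ℝ, ∀ (n : ℕ) (M : 𝒳 → ℤ), M ∈ integerPoints P T n →
      ∃ N ∈ integerPoints P T n, ‖scaledDeviation P n N‖ ≤ D / √n := by
  obtain ⟨D, hD⟩ := exists_integerVector_norm_le hP hT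
  refine ⟨D, fun n M hM => ?_⟩
  obtain ⟨z, hz, hnorm⟩ := hD _ hM
  refine ⟨M + z, add_mem_integerPoints hM hz, ?_⟩
  rw [scaledDeviation_eq, map_add, ← sub_add_eq_add_sub, norm_smul, norm_inv,
    norm_of_nonneg (sqrt_nonneg _), inv_mul_eq_div]
  gcongr

end Deviation

section CondLaw

variable {𝒳 : Type*} [Finite 𝒳] [DecidableEq 𝒳] [MeasurableSpace 𝒳] [MeasurableSingletonClass 𝒳]
  {Ω : Type*} [MeasurableSpace Ω] {μ : Measure Ω} {X : ℕ → Ω → 𝒳}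

theorem measurableSet_empiricalType_mem (hX : ∀ i, Measurable (X i)) (n : ℕ) (E : Set (𝒳 → ℝ)) :
    MeasurableSet {ω | empiricalType X n ω ∈ E} := by
  simp only [empiricalType_eq]
  exact measurable_intCounts hX n
    (MeasurableSet.of_discrete (s := {N | (n : ℝ)⁻¹ • castVector N ∈ E}))

theorem condMomentPMF_eq (hX : ∀ i, Measurable (X i)) (E : Set (𝒳 → ℝ)) {q : ℕ}
    (f : 𝒳 → Fin q → ℝ) (n : ℕ) (γ : Fin q → ℝ) :
    condMomentPMF μ X E f n γ = (μ.real {ω | empiricalType X n ω ∈ E})⁻¹ *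
      μ.real {ω | empiricalType X n ω ∈ E ∧ sampleMoment X f n ω = γ} := by
  rw [condMomentPMF, condLaw, measureReal_def, cond_apply (measurableSet_empiricalType_mem hX n E),
    ENNReal.toReal_mul, ENNReal.toReal_inv]
  rfl

theorem condLaw_le_ofReal [IsFiniteMeasure μ] (hX : ∀ i, Measurable (X i)) {E : Set (𝒳 → ℝ)}
    {n : ℕ} {s t : Set Ω} {ε : ℝ} (hε : 0 ≤ ε)
    (hst : 0 < μ.real {ω | empiricalType X n ω ∈ E} → ∀ ω, empiricalType X n ω ∈ E → ω ∈ s → ω ∈ t)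
    (ht : μ.real {ω | empiricalType X n ω ∈ E ∧ ω ∈ t} ≤
      ε * μ.real {ω | empiricalType X n ω ∈ E}) :
    condLaw μ X E n s ≤ ENNReal.ofReal ε := by
  rcases eq_or_ne (μ {ω | empiricalType X n ω ∈ E}) 0 with hE | hE
  · simp [condLaw, cond_eq_zero_of_meas_eq_zero hE]
  have hE_pos := ENNReal.toReal_pos hE (measure_ne_top _ _)
  rw [condLaw, cond_apply (measurableSet_empiricalType_mem hX n E), mul_comm, ← div_eq_mul_inv]
  refine ENNReal.div_le_of_le_mul ?_
  calc _ ≤ μ {ω | empiricalType X n ω ∈ E ∧ ω ∈ t} :=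
        measure_mono fun ω hω => ⟨hω.1, hst hE_pos ω hω.1 hω.2⟩
    _ = ENNReal.ofReal (μ.real {ω | empiricalType X n ω ∈ E ∧ ω ∈ t}) :=
        (ofReal_measureReal (measure_ne_top _ _)).symm
    _ ≤ ENNReal.ofReal (ε * μ.real {ω | empiricalType X n ω ∈ E}) := ENNReal.ofReal_le_ofReal ht
    _ = _ := by rw [ENNReal.ofReal_mul hε, ofReal_measureReal (measure_ne_top _ _)]

end CondLaw

variable {𝒳 : Type*} [Fintype 𝒳] {q d n : ℕ} {h : 𝒳 → Fin d → ℝ} {a : Fin d → ℝ} {P Q : 𝒳 → ℝ}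
  {f : 𝒳 → Fin q → ℝ}

/-- The directions in which neither the constraint nor the moment of `f` changes. The counts with
a given value of the sample moment form a coset of the integer vectors in this space. -/
abbrev levelTangentSpace (h : 𝒳 → Fin d → ℝ) (f : 𝒳 → Fin q → ℝ) : Submodule ℝ (𝒳 → ℝ) :=
  tangentSpace h ⊓ LinearMap.ker (momentMap f)

variable [DecidableEq 𝒳] {Ω : Type*} {X : ℕ → Ω → 𝒳} {ω : Ω}

theorem intCounts_mem_integerPoints (hP : P ∈ constraintSet h a) (hn : n ≠ 0)
    (hω : empiricalType X n ω ∈ constraintSet h a) :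
    intCounts X n ω ∈ integerPoints P (tangentSpace h) n :=
  ((empiricalType_mem_constraintSet_iff hP X hn ω).1 hω).2

theorem intCounts_sub_mem_integerVectors (hP : P ∈ constraintSet h a) (hn : n ≠ 0)
    (hω : empiricalType X n ω ∈ constraintSet h a) {N : 𝒳 → ℤ}
    (hN : N ∈ integerPoints P (tangentSpace h) n) :
    intCounts X n ω - N ∈ integerVectors (tangentSpace h) := by
  rw [mem_integerVectors, map_sub, ← sub_sub_sub_cancel_right _ _ ((n : ℝ) • P)]
  exact Submodule.sub_mem _ (intCounts_mem_integerPoints hP hn hω) hN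

theorem sampleMoment_eq_iff (hP : P ∈ constraintSet h a) (hn : n ≠ 0)
    (hω : empiricalType X n ω ∈ constraintSet h a) {N : 𝒳 → ℤ}
    (hN : N ∈ integerPoints P (tangentSpace h) n) :
    sampleMoment X f n ω = (n : ℝ)⁻¹ • momentMap f (castVector N) ↔
      intCounts X n ω - N ∈ integerVectors (levelTangentSpace h f) := by
  have hn' : (n : ℝ)⁻¹ ≠ 0 := by positivity
  have htangent := mem_integerVectors.1 (intCounts_sub_mem_integerVectors hP hn hω hN)
  rw [mem_integerVectors, Submodule.mem_inf, and_iff_right htangent, LinearMap.mem_ker, map_sub,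
    map_sub, sub_eq_zero, sampleMoment_eq, smul_right_inj hn']

variable [MeasurableSpace 𝒳] [MeasurableSingletonClass 𝒳] [MeasurableSpace Ω] {μ : Measure Ω}

theorem exists_condMomentPMF_eq (hX : IsIIDSample μ Q X) (hQ : ∀ x, 0 < Q x)
    (hP : IsInformationProjection Q (constraintSet h a) P) (f : 𝒳 → Fin q → ℝ) (hn : n ≠ 0)
    (hE : 0 < μ.real {ω | empiricalType X n ω ∈ constraintSet h a}) :
    ∃ K : ℝ, 0 < K ∧ ∀ N ∈ integerPoints P (tangentSpace h) n,
      condMomentPMF μ X (constraintSet h a) f n ((n : ℝ)⁻¹ • momentMap f (castVector N)) =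
        K * ∑' z : integerVectors (levelTangentSpace h f), countWeight P n (N + z) := by
  obtain ⟨K, hK, hcoset⟩ := exists_measureReal_coset_eq hX hQ hP hn
  refine ⟨(μ.real {ω | empiricalType X n ω ∈ constraintSet h a})⁻¹ * K, by positivity,
    fun N hN => ?_⟩
  have hevent : {ω | empiricalType X n ω ∈ constraintSet h a ∧
      sampleMoment X f n ω = (n : ℝ)⁻¹ • momentMap f (castVector N)} =
      {ω | empiricalType X n ω ∈ constraintSet h a ∧
        intCounts X n ω - N ∈ integerVectors (levelTangentSpace h f) ∧
          intCounts X n ω ∈ Set.univ} := by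
    ext ω
    simp only [Set.mem_univ, and_true, Set.mem_ofPred_eq]
    exact and_congr_right fun hω => sampleMoment_eq_iff hP.1 hn hω hN
  rw [condMomentPMF_eq hX.measurable, hevent, hcoset _ inf_le_left N hN, Set.indicator_univ,
    mul_assoc]

theorem exists_abs_condMomentPMF_div_sub_le (hX : IsIIDSample μ Q X) (hQ : ∀ x, 0 < Q x)
    (hP : IsInformationProjection Q (constraintSet h a) P)
    (hlattice : SpannedByIntegerVectors (levelTangentSpace h f)) :
    ∃ I : ℝ, 0 < I ∧ ∃ C : ℝ, 0 ≤ C ∧ ∀ n : ℕ, n ≠ 0 →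
      0 < μ.real {ω | empiricalType X n ω ∈ constraintSet h a} → ∃ A : ℝ, 0 < A ∧
      ∀ N ∈ integerPoints P (tangentSpace h) n,
        |condMomentPMF μ X (constraintSet h a) f n ((n : ℝ)⁻¹ • momentMap f (castVector N)) / A -
          I * exp (-(‖normalDeviation P (levelTangentSpace h f) n N‖ ^ 2 / 2))| ≤ C / √n := by
  obtain ⟨I, hI, C, hC, hsum⟩ :=
    exists_abs_tsum_countWeight_sub_le hP.1.1 hlattice fun v hv => hv.1.1
  refine ⟨I, hI, C, hC, fun n hn hE => ?_⟩
  obtain ⟨K, hK, hpmf⟩ := exists_condMomentPMF_eq hX hQ hP f hn hE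
  set A := √n ^ finrank ℝ (levelTangentSpace h f)
  have hA : 0 < A := by positivity
  refine ⟨K * A, by positivity, fun N hN => ?_⟩
  have hbound := hsum n N hn (sum_eq_of_mem_integerPoints hP.1.1 hN)
  rwa [hpmf N hN, mul_div_mul_left _ _ hK.ne', div_sub' hA.ne', abs_div, abs_of_pos hA,
    div_le_iff₀' hA, ← mul_assoc]

theorem condMomentPMF_div_le (hX : ∀ i, Measurable (X i)) (hP : P ∈ constraintSet h a)
    (hn : n ≠ 0) {A I δ : ℝ} (hI : 0 ≤ I) (hδ : 0 ≤ δ)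
    (hpmf : ∀ N ∈ integerPoints P (tangentSpace h) n,
      |condMomentPMF μ X (constraintSet h a) f n ((n : ℝ)⁻¹ • momentMap f (castVector N)) / A -
        I * exp (-(‖normalDeviation P (levelTangentSpace h f) n N‖ ^ 2 / 2))| ≤ δ)
    (γ : Fin q → ℝ) : condMomentPMF μ X (constraintSet h a) f n γ / A ≤ I + δ := by
  rcases Set.eq_empty_or_nonempty {ω | empiricalType X n ω ∈ constraintSet h a ∧
      sampleMoment X f n ω = γ} with hempty | ⟨ω, hω, rfl⟩
  · rw [condMomentPMF_eq hX, hempty, measureReal_empty, mul_zero, zero_div]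
    positivity
  · have hle := (abs_le.1 (hpmf _ (intCounts_mem_integerPoints hP hn hω))).2
    rw [← sampleMoment_eq] at hle
    set m := normalDeviation P (levelTangentSpace h f) n (intCounts X n ω)
    have hexp : exp (-(‖m‖ ^ 2 / 2)) ≤ 1 := exp_le_one_iff.2 (by rw [neg_nonpos]; positivity)
    linarith [mul_le_mul_of_nonneg_left hexp hI]

theorem exists_abs_iSup_condMomentPMF_div_sub_le (hX : ∀ i, Measurable (X i))
    (hP : P ∈ constraintSet h a) (hlattice : SpannedByIntegerVectors (tangentSpace h)) {I C : ℝ}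
    (hI : 0 ≤ I) (hC : 0 ≤ C) :
    ∃ C' : ℝ, C ≤ C' ∧ ∀ n : ℕ, n ≠ 0 →
      (∃ ω, empiricalType X n ω ∈ constraintSet h a) → ∀ A : ℝ, 0 < A →
      (∀ N ∈ integerPoints P (tangentSpace h) n,
        |condMomentPMF μ X (constraintSet h a) f n ((n : ℝ)⁻¹ • momentMap f (castVector N)) / A -
          I * exp (-(‖normalDeviation P (levelTangentSpace h f) n N‖ ^ 2 / 2))| ≤ C / √n) →
      |(⨆ γ, condMomentPMF μ X (constraintSet h a) f n γ) / A - I| ≤ C' / √n := by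
  obtain ⟨D, hD⟩ := exists_mem_integerPoints_norm_scaledDeviation_le hP.1 hlattice
  have hCD : C ≤ C + I * D ^ 2 := le_add_of_nonneg_right (by positivity)
  refine ⟨C + I * D ^ 2, hCD, fun n hn ⟨ω, hω⟩ A hA hpmf => ?_⟩
  have hsqrt : 1 ≤ √(n : ℝ) := one_le_sqrt.2 (by exact_mod_cast Nat.one_le_iff_ne_zero.2 hn)
  obtain ⟨N, hN, hnear⟩ := hD n _ (intCounts_mem_integerPoints hP hn hω)
  set m := normalDeviation P (levelTangentSpace h f) n N
  have hexp : 1 - D ^ 2 / √n ≤ exp (-(‖m‖ ^ 2 / 2)) :=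
    one_sub_sq_div_le_exp_neg hsqrt (norm_nonneg m) ((norm_normalDeviation_le _ _ _ _).trans hnear)
  have hsup : (⨆ γ, condMomentPMF μ X (constraintSet h a) f n γ) / A =
      ⨆ γ, condMomentPMF μ X (constraintSet h a) f n γ / A := by
    simp only [div_eq_mul_inv]
    exact iSup_mul_of_nonneg (inv_nonneg.2 hA.le) _
  rw [hsup]
  refine abs_ciSup_sub_le (fun γ => ?_) (i := (n : ℝ)⁻¹ • momentMap f (castVector N)) ?_
  · refine (condMomentPMF_div_le hX hP hn hI (by positivity) hpmf γ).trans ?_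
    gcongr
  · have hmode := mul_le_mul_of_nonneg_left hexp hI
    have hsplit : I - (C + I * D ^ 2) / √n = I * (1 - D ^ 2 / √n) - C / √n := by ring
    linarith [(abs_le.1 (hpmf N hN)).1]

end ConditionalLikelihood

section Expansion

open Filter Module Real

variable {𝒳 : Type*} [Fintype 𝒳]

theorem exists_eventually_le_tsum_countWeight {P : 𝒳 → ℝ} (hP : P ∈ openSimplex 𝒳)
    {S : Submodule ℝ (𝒳 → ℝ)} (hS : SpannedByIntegerVectors S) (hS₀ : ∀ v ∈ S, ∑ x, v x = 0) :
    ∃ c : ℝ, 0 < c ∧ ∀ᶠ n : ℕ in atTop, ∀ N ∈ integerPoints P S n, ∑ x, N x = n →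
      √n ^ finrank ℝ S * c ≤ ∑' z : integerVectors S, countWeight P n (N + z) := by
  obtain ⟨I, hI, C, -, hsum⟩ := exists_abs_tsum_countWeight_sub_le hP hS hS₀
  have hsmall : ∀ᶠ n : ℕ in atTop, C / √n ≤ I / 2 :=
    ((tendsto_sqrt_atTop.comp tendsto_natCast_atTop_atTop).const_div_atTop C).eventually_le_const
      (half_pos hI)
  refine ⟨I / 2, half_pos hI, ?_⟩
  filter_upwards [hsmall, eventually_ne_atTop 0] with n hn hn₀ N hN hNsum
  have hlower := (abs_le.1 (hsum n N hn₀ hNsum)).1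
  rw [normalDeviation_eq_zero hN, norm_zero, zero_pow two_ne_zero, zero_div, neg_zero, exp_zero,
    mul_one] at hlower
  have herror : √n ^ finrank ℝ S * (C / √n) ≤ √n ^ finrank ℝ S * (I / 2) := by gcongr
  linarith

variable [DecidableEq 𝒳] {Ω : Type*} {X : ℕ → Ω → 𝒳} {q d : ℕ} {h : 𝒳 → Fin d → ℝ}
  {a : Fin d → ℝ} {P Q : 𝒳 → ℝ} {f : 𝒳 → Fin q → ℝ}

theorem norm_sq_normalDeviation_intCounts (hP : P ∈ constraintSet h a) (hf : momentMap f P = 0)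
    {W : Matrix (Fin q) (Fin q) ℝ}
    (hW : ∀ u, IsLeast {e : ℝ | ∃ v ∈ tangentSpace h, momentMap f v = u ∧
      e = ∑ x, v x ^ 2 / P x} (u ⬝ᵥ (W *ᵥ u)))
    {n : ℕ} (hn : n ≠ 0) {ω : Ω} (hω : empiricalType X n ω ∈ constraintSet h a) :
    ‖normalDeviation P (levelTangentSpace h f) n (intCounts X n ω)‖ ^ 2 =
      n * (sampleMoment X f n ω ⬝ᵥ (W *ᵥ sampleMoment X f n ω)) := by
  have hscale : (√n)⁻¹ • momentMap f (castVector (intCounts X n ω)) =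
      √n • sampleMoment X f n ω := by
    rw [sampleMoment_eq, smul_smul, ← div_eq_mul_inv, sqrt_div_self]
  have hleast := isLeast_norm_sq_normalDeviation (fun x => (hP.1.1 x).le) hf
    (intCounts_mem_integerPoints hP hn hω)
  rw [hleast.unique (hW _), hscale, mulVec_smul, dotProduct_smul, smul_dotProduct, smul_eq_mul,
    smul_eq_mul, ← mul_assoc, mul_self_sqrt n.cast_nonneg]

variable [MeasurableSpace 𝒳] [MeasurableSingletonClass 𝒳] [MeasurableSpace Ω] {μ : Measure Ω}

theorem exists_measureReal_constraint_eq (hX : IsIIDSample μ Q X) (hQ : ∀ x, 0 < Q x)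
    (hP : IsInformationProjection Q (constraintSet h a) P) {n : ℕ} (hn : n ≠ 0) :
    ∃ K : ℝ, 0 < K ∧ ∀ N ∈ integerPoints P (tangentSpace h) n, ∀ B : Set (𝒳 → ℤ),
      μ.real {ω | empiricalType X n ω ∈ constraintSet h a ∧ intCounts X n ω ∈ B} =
        K * ∑' z : integerVectors (tangentSpace h), B.indicator (countWeight P n) (N + z) := by
  obtain ⟨K, hK, hcoset⟩ := exists_measureReal_coset_eq hX hQ hP hn
  refine ⟨K, hK, fun N hN B => ?_⟩
  rw [← hcoset _ le_rfl N hN B]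
  congr 1
  ext ω
  exact and_congr_right fun hω =>
    (and_iff_right (intCounts_sub_mem_integerVectors hP.1 hn hω hN)).symm

theorem exists_eventually_measureReal_tail_le (hX : IsIIDSample μ Q X) (hQ : ∀ x, 0 < Q x)
    (hP : IsInformationProjection Q (constraintSet h a) P)
    (hlattice : SpannedByIntegerVectors (tangentSpace h)) {ε : ℝ} (hε : 0 < ε) :
    ∃ K : ℝ, ∀ᶠ n : ℕ in atTop,
      μ.real {ω | empiricalType X n ω ∈ constraintSet h a ∧
        K < ‖scaledDeviation P n (intCounts X n ω)‖ ^ 2} ≤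
      ε * μ.real {ω | empiricalType X n ω ∈ constraintSet h a} := by
  obtain ⟨b, hb, hmass⟩ := exists_eventually_le_tsum_countWeight hP.1.1 hlattice fun v hv => hv.1
  obtain ⟨C, -, c, hc, htail⟩ := exists_tsum_countWeight_tail_le hP.1.1 hlattice fun v hv => hv.1
  obtain ⟨K, hK⟩ : ∃ K, C * exp (-(c * K)) ≤ ε * b := by
    have hlim : Tendsto (fun K => C * exp (-(c * K))) atTop (nhds 0) := by
      simpa using (tendsto_exp_neg_atTop_nhds_zero.comp
        (tendsto_id.const_mul_atTop hc)).const_mul C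
    exact (hlim.eventually_le_const (mul_pos hε hb)).exists
  refine ⟨K, ?_⟩
  filter_upwards [hmass, eventually_ne_atTop 0] with n hmass hn
  rcases Set.eq_empty_or_nonempty {ω | empiricalType X n ω ∈ constraintSet h a} with hE | ⟨ω, hω⟩
  · have htail_empty : {ω | empiricalType X n ω ∈ constraintSet h a ∧
        K < ‖scaledDeviation P n (intCounts X n ω)‖ ^ 2} = ∅ :=
      Set.subset_eq_empty (fun ω hω => hω.1) hE
    rw [htail_empty, hE, measureReal_empty, mul_zero]
  obtain ⟨κ, hκ, hevent⟩ := exists_measureReal_constraint_eq hX hQ hP hn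
  have hN := intCounts_mem_integerPoints hP.1 hn hω
  have hsum := sum_eq_of_mem_integerPoints hP.1.1 hN
  set N := intCounts X n ω
  set k := finrank ℝ (tangentSpace h)
  have hall := hevent N hN Set.univ
  simp only [Set.mem_univ, and_true, Set.indicator_univ] at hall
  calc _ = κ * ∑' z : integerVectors (tangentSpace h),
          {M | K < ‖scaledDeviation P n M‖ ^ 2}.indicator (countWeight P n) (N + z) :=
        hevent N hN {M | K < ‖scaledDeviation P n M‖ ^ 2}
    _ ≤ κ * (√n ^ k * (C * exp (-(c * K)))) := by
        gcongr
        exact htail n N K hn hsum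
    _ ≤ κ * (√n ^ k * (ε * b)) := by gcongr
    _ = ε * (κ * (√n ^ k * b)) := by ring
    _ ≤ ε * (κ * ∑' z : integerVectors (tangentSpace h), countWeight P n (N + z)) := by
        gcongr
        exact hmass N hN hsum
    _ = _ := by rw [hall]

theorem exists_eventually_abs_neg_log_condLikelihood_sub_le (hX : IsIIDSample μ Q X)
    (hQ : ∀ x, 0 < Q x) (hP : IsInformationProjection Q (constraintSet h a) P)
    (hlattice : SpannedByIntegerVectors (tangentSpace h))
    (hlattice' : SpannedByIntegerVectors (levelTangentSpace h f)) (K : ℝ) :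
    ∃ C : ℝ, ∀ᶠ n : ℕ in atTop, 0 < μ.real {ω | empiricalType X n ω ∈ constraintSet h a} →
      ∀ ω, empiricalType X n ω ∈ constraintSet h a →
        ‖scaledDeviation P n (intCounts X n ω)‖ ^ 2 ≤ K →
        |-log (condLikelihood μ X (constraintSet h a) f n ω) -
          ‖normalDeviation P (levelTangentSpace h f) n (intCounts X n ω)‖ ^ 2 / 2| ≤ C / √n := by
  obtain ⟨I, hI, C₁, hC₁, hpmf⟩ := exists_abs_condMomentPMF_div_sub_le hX hQ hP hlattice'
  obtain ⟨C₂, hC, hsup⟩ := exists_abs_iSup_condMomentPMF_div_sub_le (μ := μ) (f := f)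
    hX.measurable hP.1 hlattice hI.le hC₁
  obtain ⟨C, hlog⟩ := exists_eventually_abs_neg_log_div_sub_le (C := C₂) hI K
  refine ⟨C, ?_⟩
  filter_upwards [(tendsto_sqrt_atTop.comp tendsto_natCast_atTop_atTop).eventually hlog,
    eventually_ne_atTop 0] with n hlog hn hE ω hω hK
  obtain ⟨A, hA, hpmf⟩ := hpmf n hn hE
  have hnormal : ‖normalDeviation P (levelTangentSpace h f) n (intCounts X n ω)‖ ^ 2 ≤ K :=
    (pow_le_pow_left₀ (norm_nonneg _) (norm_normalDeviation_le _ _ _ _) 2).trans hK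
  have hobs := hpmf _ (intCounts_mem_integerPoints hP.1 hn hω)
  rw [← sampleMoment_eq] at hobs
  have hobs' := hobs.trans (div_le_div_of_nonneg_right hC (sqrt_nonneg n))
  simpa only [condLikelihood, Function.comp_apply, div_div_div_cancel_right₀ hA.ne'] using
    hlog _ _ _ hnormal hobs' (hsup n hn ⟨ω, hω⟩ A hA hpmf)

theorem isBigOInProbability_condLikelihood (hX : IsIIDSample μ Q X) (hQ : ∀ x, 0 < Q x)
    (hP : IsInformationProjection Q (constraintSet h a) P) (hf : momentMap f P = 0)
    (hlattice : SpannedByIntegerVectors (tangentSpace h))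
    (hlattice' : SpannedByIntegerVectors (levelTangentSpace h f)) {W : Matrix (Fin q) (Fin q) ℝ}
    (hW : ∀ u, IsLeast {e : ℝ | ∃ v ∈ tangentSpace h, momentMap f v = u ∧
      e = ∑ x, v x ^ 2 / P x} (u ⬝ᵥ (W *ᵥ u))) :
    IsBigOInProbability (fun n => condLaw μ X (constraintSet h a) n)
      (fun n ω => -log (condLikelihood μ X (constraintSet h a) f n ω) -
        (n : ℝ) / 2 * (sampleMoment X f n ω ⬝ᵥ (W *ᵥ sampleMoment X f n ω)))
      (fun n => (n : ℝ) ^ (-(1 / 2) : ℝ)) := by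
  intro ε hε
  have := hX.indep.isProbabilityMeasure
  obtain ⟨K, htail⟩ := exists_eventually_measureReal_tail_le hX hQ hP hlattice hε
  obtain ⟨C, hlog⟩ :=
    exists_eventually_abs_neg_log_condLikelihood_sub_le hX hQ hP hlattice hlattice' K
  refine ⟨C, eventually_atTop.1 ?_⟩
  filter_upwards [htail, hlog, eventually_ne_atTop 0] with n htail hlog hn
  refine condLaw_le_ofReal hX.measurable hε.le (fun hE ω hω hfar => ?_) htail
  contrapose! hfar
  have hrate : (n : ℝ) ^ (-(1 / 2) : ℝ) = (√n)⁻¹ := by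
    rw [rpow_neg n.cast_nonneg, sqrt_eq_rpow]
  have hclose := hlog hE ω hω (not_lt.1 hfar)
  rw [norm_sq_normalDeviation_intCounts hP.1 hf hW hn hω, mul_div_right_comm] at hclose
  rw [Set.notMem_ofPred_iff, not_lt, hrate, ← div_eq_mul_inv]
  exact hclose

end Expansion

end ConstrainedGMM

end

theorem mainTheorem5
    {𝒳 : Type*} [Fintype 𝒳] [DecidableEq 𝒳] [MeasurableSpace 𝒳] [MeasurableSingletonClass 𝒳]
    {Ω : Type*} [MeasurableSpace Ω] (μ : Measure Ω) [IsProbabilityMeasure μ]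
    -- independent draws from a reference distribution of full support
    (Q : 𝒳 → ℝ) (hQ : ∀ x, 0 < Q x)
    (X : ℕ → Ω → 𝒳) (hX : ∀ i, Measurable (X i)) (hindep : iIndepFun X μ)
    (hlaw : ∀ i x, μ.real {ω | X i ω = x} = Q x)
    -- constraints `E_P[h(X)] = α(θ)`, moment function `g(x, θ)`, information projections `P*_θ`
    {Θ : Type*} {d q r : ℕ} (h : 𝒳 → Fin d → ℝ) (α : Θ → Fin d → ℝ)
    (g : 𝒳 → Θ → Fin q → ℝ) (Pstar : Θ → 𝒳 → ℝ)
    (hproj : ∀ θ, ConstrainedGMM.IsInformationProjection Q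
      (ConstrainedGMM.constraintSet h (α θ)) (Pstar θ))
    -- the moment condition holds at the projection
    (hmoment : ∀ θ, ConstrainedGMM.momentMap (fun x => g x θ) (Pstar θ) = 0)
    -- the moment map restricted to the tangent space has full rank
    (hrank : ∀ θ, (ConstrainedGMM.tangentSpace h).map
      (ConstrainedGMM.momentMap fun x => g x θ) = ⊤)
    -- lattice conditions
    (hlattice : ConstrainedGMM.SpannedByIntegerVectors (ConstrainedGMM.tangentSpace h))
    (hlattice' : ∀ θ, ConstrainedGMM.SpannedByIntegerVectors
      (ConstrainedGMM.tangentSpace h ⊓ LinearMap.ker (ConstrainedGMM.momentMap fun x => g x θ)))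
    -- an orthonormal basis of the tangent space
    (V : Matrix 𝒳 (Fin r) ℝ)
    (hV : ConstrainedGMM.IsOrthonormalBasisOf V (ConstrainedGMM.tangentSpace h)) :
    ∀ θ : Θ,
      -- both matrices that are inverted are positive definite
      (ConstrainedGMM.projectedHessian V (Pstar θ)).PosDef ∧
      (ConstrainedGMM.pushforwardMetric (fun x => g x θ) V (Pstar θ)).PosDef ∧
      -- the weight is the metric induced on moment space by the information metric
      (∀ u : Fin q → ℝ, IsLeast
        {e : ℝ | ∃ v ∈ ConstrainedGMM.tangentSpace h,
          ConstrainedGMM.momentMap (fun x => g x θ) v = u ∧ e = ∑ x, v x ^ 2 / Pstar θ x}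
        (u ⬝ᵥ (ConstrainedGMM.optimalWeight (fun x => g x θ) V (Pstar θ) *ᵥ u))) ∧
      -- the second-order expansion of the conditional negative log-likelihood
      ConstrainedGMM.IsBigOInProbability
        (fun n => ConstrainedGMM.condLaw μ X (ConstrainedGMM.constraintSet h (α θ)) n)
        (fun n ω =>
          -Real.log (ConstrainedGMM.condLikelihood μ X (ConstrainedGMM.constraintSet h (α θ))
              (fun x => g x θ) n ω)
            - (n : ℝ) / 2 *
              (ConstrainedGMM.sampleMoment X (fun x => g x θ) n ω ⬝ᵥ
                (ConstrainedGMM.optimalWeight (fun x => g x θ) V (Pstar θ) *ᵥ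
                  ConstrainedGMM.sampleMoment X (fun x => g x θ) n ω)))
        (fun n => (n : ℝ) ^ (-(1 / 2) : ℝ)) := by
  intro θ
  have hpos := (hproj θ).1.1.1
  have hleast := ConstrainedGMM.isLeast_optimalWeight hV hpos (hrank θ)
  exact ⟨ConstrainedGMM.posDef_projectedHessian hV hpos,
    ConstrainedGMM.posDef_pushforwardMetric hV hpos (hrank θ), hleast,
    ConstrainedGMM.isBigOInProbability_condLikelihood ⟨hX, hindep, hlaw⟩ hQ (hproj θ) (hmoment θ)
      hlattice (hlattice' θ) hleast⟩
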